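/- **Model.** There are $T\ge 2$ rounds, $B$ units $b\in\mathcal B$ (each of size $1$, divisible), and a finite non-empty set $\Theta$ of types with weights $w_\theta>0$. In round $t\in[T]$, $N_{t,\theta}\ge 1$ (a.s.) individuals of type $\theta$ arrive; $N_t=\sum_\theta N_{t,\theta}$, $N=\sum_{t\le T}N_t$, $N_{(s,t]}=\sum_{s<r\le t}N_r$, $N_{>t}=N_{(t,T]}$. Unit $b$ perishes at the end of round $T_b\in\{1,2,\dots\}$. All $N_{t,\theta}$ and all $T_b$ are mutually independent, and $|N_{t,\theta}-\mathbb E N_{t,\theta}|$ has a finite least almost sure bound $\rho_{t,\theta}$. The bijection $\sigma:\mathcal B\to[B]$ is a fixed allocation schedule. Put $\beta_{avg}=B/\mathbb E N$, $w_{max}=\max_\theta w_\theta$, $\mu_{\max}=\max_t\mathbb E N_t$, $\rho_{\max}=\max_{t,\theta}\rho_{t,\theta}$, and let $\sigma^2_{\min},\sigma^2_{\max}$ be the minimum and the maximum of $\mathrm{Var}(N_{t,\theta})$. Let $\delta\in(0,1)$ and $L_T>0$. **Confidence terms.** For $0\le s\le t\le T$ let $\mathrm{Conf}^N_{s,t}=\sqrt{2(t-s)|\Theta|\rho_{\max}^2\log(2T^2/\delta)}$,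 $\underline N_{(s,t]}=\mathbb E N_{(s,t]}-\mathrm{Conf}^N_{s,t}$, $\overline N_{>t}=\mathbb E N_{>t}+\mathrm{Conf}^N_{t,T}$, $\overline N=\overline N_{>0}$. With $\ell_t=\log(3t\log T/\delta)$ let $\mathrm{Conf}^P_t(x)=\frac12\big(\ell_t+\sqrt{\ell_t^2+8x\ell_t}\big)$. **Guardrail and perishing-induced loss.** For $X\ge0$ let $\tau_b(t\mid X)=\inf\{t'\in[t,T]:\underline N_{(0,t-1]}X+\underline N_{(t-1,t']}X\ge\sigma(b)\}$ (with $\inf\emptyset=\infty$), $\mu(X)=\sum_b\Pr(T_b<\min\{T,\tau_b(1\mid X)\})$, $\overline\Delta(X)=\min\{B,\mu(X)+\mathrm{Conf}^P_1(\mu(X))\}$, $\underline X=\sup\{X\ge 0: X\le (B-\overline\Delta(X))/\overline N\}$ and $\mathcal L^{\mathsf{perish}}=B/\overline N-\underline X$. **Algorithm (Perishing-Guardrail).** Let $\overline P_0=B$ and $\overline P_t=\min\{\overline P_{t-1},\eta_t+\mathrm{Conf}^P_t(\eta_t)\}$, where $\eta_t=\sum_{b:\,\sigma(b)\ge\lceil\underline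 N_{(0,t-1]}\underline X\rceil}\Pr(t\le T_b<\min\{T,\tau_b(t\mid\underline X)\})$. Let $B_t$ be the quantity left at the beginning of round $t$ ($B_1=B$). In round $t$ every individual receives $X_{t,\theta}=B_t/N_t$ if $B_t<N_t\underline X$; otherwise $X_{t,\theta}=\underline X+L_T$ if $B_t-N_t(\underline X+L_T)\ge\underline X\,\overline N_{>t}+\overline P_t$; otherwise $X_{t,\theta}=\underline X$. The total amount is taken from the remaining units in the order of $\sigma$ (the last one possibly fractionally), and then whatever is left of the units with $T_b=t$ is lost. Let $$\Delta_{EF}=\max_{t,\theta}\Big|w_\theta\Big(X_{t,\theta}-\frac BN\Big)\Big|,\qquad \Delta_{\text{efficiency}}=B-\sum_{t,\theta}N_{t,\theta}X_{t,\theta}.$$ **Notation.** $a\lesssim b$ (equivalently $b\gtrsim a$) means $a\le K M^k\,b$ for constants $K,k$, where $M$ is the product of $1+x$ over $x\in\{\beta_{avg},|\Theta|,w_{max},\mu_{\max},\sigma^2_{\min},\sigma^2_{\max},\rho_{\max},\log T,\log(1/\delta)\}$. Constants in the conclusions depend only on those in the hypotheses, and not on the instance, $T$, $\delta$ or $L_T$.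 **Statement (high envy, low perishing).** Suppose $L_T\lesssim 1$ (in particular this covers $L_T=o(1)$), $L_T\gtrsim 1/\sqrt T$ and $\mathcal L^{\mathsf{perish}}\lesssim 1/\sqrt T$. 1. If $T\mathcal L^{\mathsf{perish}}\lesssim L_T^{-1}$, then with probability at least $1-2\delta$ Perishing-Guardrail achieves both $\Delta_{EF}\lesssim L_T$ and $\Delta_{\text{efficiency}}\lesssim L_T^{-1}$. 2. If $T\mathcal L^{\mathsf{perish}}\gtrsim L_T^{-1}$, then with probability at least $1-2\delta$ it achieves both $\Delta_{EF}\lesssim L_T$ and $\Delta_{\text{efficiency}}\lesssim T\mathcal L^{\mathsf{perish}}$. -/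

import Mathlib

open MeasureTheory ProbabilityTheory

/-- An instance of online allocation of perishable units. Rounds are `1, …, T`, the units are the
elements of `Fin B`, types are the elements of `Θ`. -/
structure PerishingInstance (Ω Θ : Type*) where
  /-- number of rounds -/
  T : ℕ
  /-- number of units -/
  B : ℕ
  /-- utility weights: `u_θ(x) = w_θ x` -/
  w : Θ → ℝ
  /-- `N t θ` is the number of arrivals of type `θ` in round `t` (used for `1 ≤ t ≤ T` only) -/
  N : ℕ → Θ → Ω → ℕ
  /-- `perishTime b` is the perishing time of unit `b` -/
  perishTime : Fin B → Ω → ℕ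
  /-- the allocation schedule; the rank of `b` in it is `σ b + 1` -/
  σ : Equiv.Perm (Fin B)

namespace PerishingInstance

variable {Ω Θ : Type*} [MeasurableSpace Ω] [Fintype Θ]

/-- The standing assumptions of the model. -/
structure Admissible (I : PerishingInstance Ω Θ) (P : Measure Ω) : Prop where
  two_le_T : 2 ≤ I.T
  w_pos : ∀ θ, 0 < I.w θ
  measurable_N : ∀ t ∈ Finset.Icc 1 I.T, ∀ θ, Measurable (I.N t θ)
  measurable_perishTime : ∀ b, Measurable (I.perishTime b)
  /-- all arrival counts and all perishing times are mutually independent -/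
  indep : iIndepFun
    (Sum.elim (fun i : Finset.Icc 1 I.T × Θ => I.N i.1 i.2) I.perishTime) P
  one_le_N : ∀ t ∈ Finset.Icc 1 I.T, ∀ θ, ∀ᵐ ω ∂P, 1 ≤ I.N t θ ω
  one_le_perishTime : ∀ b, ∀ᵐ ω ∂P, 1 ≤ I.perishTime b ω
  /-- the deviation of an arrival count from its mean is essentially bounded -/
  bounded_N : ∀ t ∈ Finset.Icc 1 I.T, ∀ θ, ∃ C : ℝ,
    ∀ᵐ ω ∂P, |(I.N t θ ω : ℝ) - ∫ ω', (I.N t θ ω' : ℝ) ∂P| ≤ C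

/-! ### Parameters of the demand process -/

/-- `N_t`, the number of arrivals in round `t` -/
noncomputable def arrivals (I : PerishingInstance Ω Θ) (ω : Ω) (t : ℕ) : ℝ :=
  ∑ θ, (I.N t θ ω : ℝ)

/-- `N`, the total number of arrivals -/
noncomputable def totalArrivals (I : PerishingInstance Ω Θ) (ω : Ω) : ℝ :=
  ∑ t ∈ Finset.Icc 1 I.T, I.arrivals ω t

/-- `E[N_t]` -/
noncomputable def meanArrivals (I : PerishingInstance Ω Θ) (P : Measure Ω) (t : ℕ) : ℝ :=
  ∑ θ, ∫ ω, (I.N t θ ω : ℝ) ∂P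

/-- `E[N_{(s,t]}]`, the expected number of arrivals in rounds `s+1, …, t` -/
noncomputable def meanIoc (I : PerishingInstance Ω Θ) (P : Measure Ω) (s t : ℕ) : ℝ :=
  ∑ r ∈ Finset.Ioc s t, I.meanArrivals P r

/-- `β_avg = B / E[N]` -/
noncomputable def betaAvg (I : PerishingInstance Ω Θ) (P : Measure Ω) : ℝ :=
  (I.B : ℝ) / I.meanIoc P 0 I.T

/-- `w_max` -/
noncomputable def wMax (I : PerishingInstance Ω Θ) : ℝ := ⨆ θ, I.w θ

/-- `μ_max = max_t E[N_t]` -/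
noncomputable def muMax (I : PerishingInstance Ω Θ) (P : Measure Ω) : ℝ :=
  ⨆ t : Finset.Icc 1 I.T, I.meanArrivals P t

/-- `σ²_{t,θ} = Var(N_{t,θ})` -/
noncomputable def varN (I : PerishingInstance Ω Θ) (P : Measure Ω) (t : ℕ) (θ : Θ) : ℝ :=
  variance (fun ω => (I.N t θ ω : ℝ)) P

noncomputable def varMin (I : PerishingInstance Ω Θ) (P : Measure Ω) : ℝ :=
  ⨅ i : Finset.Icc 1 I.T × Θ, I.varN P i.1 i.2

noncomputable def varMax (I : PerishingInstance Ω Θ) (P : Measure Ω) : ℝ :=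
  ⨆ i : Finset.Icc 1 I.T × Θ, I.varN P i.1 i.2

/-- `ρ_{t,θ}`, the least almost sure bound on `|N_{t,θ} - E[N_{t,θ}]|` -/
noncomputable def rho (I : PerishingInstance Ω Θ) (P : Measure Ω) (t : ℕ) (θ : Θ) : ℝ :=
  essSup (fun ω => |(I.N t θ ω : ℝ) - ∫ ω', (I.N t θ ω' : ℝ) ∂P|) P

noncomputable def rhoMax (I : PerishingInstance Ω Θ) (P : Measure Ω) : ℝ :=
  ⨆ i : Finset.Icc 1 I.T × Θ, I.rho P i.1 i.2

/-- A quantity is a polynomial factor of the model parameters, of `log T` and of `log (1/δ)` if it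
is at most `K * (I.factor P δ) ^ k` for constants `K` and `k`. -/
noncomputable def factor (I : PerishingInstance Ω Θ) (P : Measure Ω) (δ : ℝ) : ℝ :=
  (1 + I.betaAvg P) * (1 + (Fintype.card Θ : ℝ)) * (1 + I.wMax) * (1 + I.muMax P) *
    (1 + I.varMin P) * (1 + I.varMax P) * (1 + I.rhoMax P) *
    (1 + Real.log I.T) * (1 + Real.log (1 / δ))

/-! ### Confidence terms -/

/-- `Conf^N_{s,t}`, the confidence radius for the number of arrivals in rounds `s+1, …, t` -/
noncomputable def confN (I : PerishingInstance Ω Θ) (P : Measure Ω) (δ : ℝ) (s t : ℕ) : ℝ :=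
  √(2 * ((t : ℝ) - s) * (Fintype.card Θ : ℝ) * I.rhoMax P ^ 2 *
    Real.log (2 * (I.T : ℝ) ^ 2 / δ))

/-- the upper confidence bound on the arrivals in rounds `t+1, …, T`; for `t = 0` it is the upper
bound `\overline N` on the total number of arrivals -/
noncomputable def upperN (I : PerishingInstance Ω Θ) (P : Measure Ω) (δ : ℝ) (t : ℕ) : ℝ :=
  I.meanIoc P t I.T + I.confN P δ t I.T

/-- the lower confidence bound on the arrivals in rounds `s+1, …, t` -/
noncomputable def lowerN (I : PerishingInstance Ω Θ) (P : Measure Ω) (δ : ℝ) (s t : ℕ) : ℝ :=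
  I.meanIoc P s t - I.confN P δ s t

/-- `Conf^P_t(x)` -/
noncomputable def confP (I : PerishingInstance Ω Θ) (δ : ℝ) (t : ℕ) (x : ℝ) : ℝ :=
  (1 / 2) * (Real.log (3 * t * Real.log I.T / δ) +
    √(Real.log (3 * t * Real.log I.T / δ) ^ 2 + 8 * x * Real.log (3 * t * Real.log I.T / δ)))

/-! ### The slow consumption process and the lower guardrail -/

/-- the rank of `b` in the allocation schedule, a number in `{1, …, B}` -/
def rank (I : PerishingInstance Ω Θ) (b : Fin I.B) : ℕ := (I.σ b : ℕ) + 1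

/-- `τ_b(t ∣ X, σ)`: the first round `t' ≥ t` by which the slow process with allocation `X` has
consumed `b`, and `⊤` if there is none within the horizon -/
noncomputable def latestTime (I : PerishingInstance Ω Θ) (P : Measure Ω) (δ X : ℝ) (t : ℕ)
    (b : Fin I.B) : ℕ∞ :=
  ⨅ (t' : ℕ) (_ : t ≤ t' ∧ t' ≤ I.T ∧
    (I.rank b : ℝ) ≤ I.lowerN P δ 0 (t - 1) * X + I.lowerN P δ (t - 1) t' * X), (t' : ℕ∞)

/-- `μ(X)` -/
noncomputable def spoilMean (I : PerishingInstance Ω Θ) (P : Measure Ω) (δ X : ℝ) : ℝ :=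
  ∑ b, P.real {ω | (I.perishTime b ω : ℕ∞) < min (I.T : ℕ∞) (I.latestTime P δ X 1 b)}

/-- `\overline Δ(X)`, the worst-case perishing loss of the static allocation `X` -/
noncomputable def worstLoss (I : PerishingInstance Ω Θ) (P : Measure Ω) (δ X : ℝ) : ℝ :=
  min (I.B : ℝ) (I.spoilMean P δ X + I.confP δ 1 (I.spoilMean P δ X))

/-- `\underline X`, the lower guardrail -/
noncomputable def lowerX (I : PerishingInstance Ω Θ) (P : Measure Ω) (δ : ℝ) : ℝ :=
  sSup {X : ℝ | 0 ≤ X ∧ X ≤ ((I.B : ℝ) - I.worstLoss P δ X) / I.upperN P δ 0}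

/-- the perishing-induced loss `B / \overline N - \underline X` -/
noncomputable def perishLoss (I : PerishingInstance Ω Θ) (P : Measure Ω) (δ : ℝ) : ℝ :=
  (I.B : ℝ) / I.upperN P δ 0 - I.lowerX P δ

/-! ### The pessimistic forecast of future perishing -/

/-- the units that remain at the beginning of round `t` in the slow process -/
noncomputable def slowRemaining (I : PerishingInstance Ω Θ) (P : Measure Ω) (δ : ℝ) (t : ℕ) :
    Finset (Fin I.B) :=
  {b | ⌈I.lowerN P δ 0 (t - 1) * I.lowerX P δ⌉ ≤ (I.rank b : ℤ)}

/-- `η_t` -/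
noncomputable def eta (I : PerishingInstance Ω Θ) (P : Measure Ω) (δ : ℝ) (t : ℕ) : ℝ :=
  ∑ b ∈ I.slowRemaining P δ t,
    P.real {ω | t ≤ I.perishTime b ω ∧
      (I.perishTime b ω : ℕ∞) < min (I.T : ℕ∞) (I.latestTime P δ (I.lowerX P δ) t b)}

/-- `\overline P_t` -/
noncomputable def forecast (I : PerishingInstance Ω Θ) (P : Measure Ω) (δ : ℝ) : ℕ → ℝ
  | 0 => I.B
  | t + 1 => min (forecast I P δ t) (I.eta P δ (t + 1) + I.confP δ (t + 1) (I.eta P δ (t + 1)))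

/-! ### The algorithm Perishing-Guardrail -/

/-- The per-individual allocation chosen in round `t` when the remaining budget is `budget`: all
that is left if the lower guardrail is unaffordable, else the upper guardrail
`\underline X + L` if the threshold condition holds, else the lower guardrail. -/
noncomputable def rule (I : PerishingInstance Ω Θ) (P : Measure Ω) (δ L : ℝ) (ω : Ω) (t : ℕ)
    (budget : ℝ) : ℝ :=
  if budget < I.arrivals ω t * I.lowerX P δ then budget / I.arrivals ω t
  else if I.lowerX P δ * I.upperN P δ t + I.forecast P δ t
      ≤ budget - I.arrivals ω t * (I.lowerX P δ + L) then I.lowerX P δ + L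
  else I.lowerX P δ

/-- The quantity taken from unit `b` when the total amount `a` is handed out from the quantities
`q` in the order of the allocation schedule. -/
noncomputable def handOut (I : PerishingInstance Ω Θ) (q : Fin I.B → ℝ) (a : ℝ) (b : Fin I.B) :
    ℝ :=
  min (q b) (max 0 (a - ∑ b' with I.σ b' < I.σ b, q b'))

/-- The quantity of each unit that is left after round `t`, that is, after the allocation of round
`t` and after the units with perishing time `t` have perished; before round `1` it is `1`. -/
noncomputable def stock (I : PerishingInstance Ω Θ) (P : Measure Ω) (δ L : ℝ) (ω : Ω) :
    ℕ → Fin I.B → ℝ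
  | 0 => fun _ => 1
  | t + 1 => fun b =>
      if I.perishTime b ω = t + 1 then 0
      else stock I P δ L ω t b -
        I.handOut (stock I P δ L ω t)
          (I.arrivals ω (t + 1) * I.rule P δ L ω (t + 1) (∑ b', stock I P δ L ω t b')) b

/-- `B_t^{alg}`, the remaining budget at the beginning of round `t ≥ 1` -/
noncomputable def budget (I : PerishingInstance Ω Θ) (P : Measure Ω) (δ L : ℝ) (ω : Ω) (t : ℕ) :
    ℝ :=
  ∑ b, I.stock P δ L ω (t - 1) b

/-- `X_{t,θ}^{alg}`; it is the same for all types -/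
noncomputable def alloc (I : PerishingInstance Ω Θ) (P : Measure Ω) (δ L : ℝ) (ω : Ω) (t : ℕ) :
    ℝ :=
  I.rule P δ L ω t (I.budget P δ L ω t)

/-- counterfactual envy `Δ_EF` -/
noncomputable def envy (I : PerishingInstance Ω Θ) (P : Measure Ω) (δ L : ℝ) (ω : Ω) : ℝ :=
  ⨆ i : Finset.Icc 1 I.T × Θ,
    |I.w i.2 * (I.alloc P δ L ω i.1 - (I.B : ℝ) / I.totalArrivals ω)|

/-- inefficiency `Δ_efficiency` -/
noncomputable def inefficiency (I : PerishingInstance Ω Θ) (P : Measure Ω) (δ L : ℝ) (ω : Ω) : ℝ :=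
  (I.B : ℝ) - ∑ t ∈ Finset.Icc 1 I.T, ∑ θ, (I.N t θ ω : ℝ) * I.alloc P δ L ω t

end PerishingInstance

/-! All randomness is confined to the event `Good`: arrival counts of all intervals stay within
`confN` (Hoeffding), and spoilage counts of all rounds stay below `eta + confP` (Chernoff). A union
bound gives it probability at least `1 - 2δ`; the rest is deterministic on each good path.

Write `x = lowerX` and `D = worstLoss x`. By monotonicity `x` is a fixed point, so `x * upperN 0 + D
= B` and `D = upperN 0 * perishLoss ≲ T * perishLoss`. While everybody receives at least `x`,
consumption is ahead of the slow process, so the forecast covers all later losses. The threshold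
test reserves enough for `x` per person plus that forecast, hence `x` is always affordable
(`Good.feasible`) and every allocation is `x` or `x + L`.

Envy: `B/N - x` is `perishLoss` plus `B/N - B/upperN 0 ≲ 1/√T`, and both are `≲ L` by hypothesis.

Inefficiency (`Good.inefficiency_le`): at the last round `s` with allocation `x` the test failed, so
little beyond the reserve was left; afterwards everybody gets `x + L`. The excess of the reserve is
of order `√(T - s)`, the extra consumption at least `L * (T - s)`, and the difference is `≲ L⁻¹`
whatever `s` is. What remains is `2D` and a term of order `L`; the larger of `L⁻¹` and `T *
perishLoss` decides the case. -/

/-! ### Concentration inequalities for sums of independent variables. -/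

/-- Two-sided Hoeffding inequality for independent variables with bounded deviation. -/
theorem measureReal_hoeffding_le {Ω ι : Type*} [MeasurableSpace Ω] {P : Measure Ω}
    [IsProbabilityMeasure P] {X : ι → Ω → ℝ} (hind : iIndepFun X P)
    (hmeas : ∀ i, Measurable (X i)) (s : Finset ι) {r : ℝ}
    (hb : ∀ i ∈ s, ∀ᵐ ω ∂P, |X i ω - ∫ ω', X i ω' ∂P| ≤ r) {l : ℝ} (hl : 0 ≤ l) :
    P.real {ω | √(2 * s.card * r ^ 2 * l) < |∑ i ∈ s, (X i ω - ∫ ω', X i ω' ∂P)|}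
      ≤ 2 * Real.exp (-l) := by
  -- In the degenerate case the sub-Gaussian exponent would divide by zero, but the sum vanishes
  -- almost surely.
  rcases eq_or_ne ((s.card : ℝ) * r ^ 2) 0 with h0 | h0
  · have hz : ∀ᵐ ω ∂P, ∑ i ∈ s, (X i ω - ∫ ω', X i ω' ∂P) = 0 := by
      have hall : ∀ᵐ ω ∂P, ∀ i ∈ s, |X i ω - ∫ ω', X i ω' ∂P| ≤ r :=
        (ae_ball_iff s.countable_toSet).2 hb
      filter_upwards [hall] with ω hω
      rcases mul_eq_zero.1 h0 with h | h
      · have : s = ∅ := by simpa using h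
        simp [this]
      · have hr0 : r = 0 := by simpa using h
        refine Finset.sum_eq_zero fun i hi => ?_
        have := hω i hi
        rw [hr0] at this
        exact abs_nonpos_iff.1 this
    have : P.real {ω | √(2 * s.card * r ^ 2 * l) < |∑ i ∈ s, (X i ω - ∫ ω', X i ω' ∂P)|} = 0 := by
      rw [measureReal_def, ENNReal.toReal_eq_zero_iff]
      left
      refine measure_mono_null (t := {ω | ¬ ∑ i ∈ s, (X i ω - ∫ ω', X i ω' ∂P) = 0}) ?_
        (ae_iff.1 hz)
      intro ω hω h
      simp only [Set.mem_ofPred_eq, h, abs_zero] at hω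
      exact absurd hω (not_lt.2 (Real.sqrt_nonneg _))
    rw [this]; positivity
  · set ε := √(2 * s.card * r ^ 2 * l) with hε
    have hsub : ∀ i ∈ s, HasSubgaussianMGF (fun ω => X i ω - ∫ ω', X i ω' ∂P)
        ((‖r - (-r)‖₊ / 2) ^ 2) P := by
      intro i hi
      have hXb : ∀ᵐ ω ∂P, X i ω ∈ Set.Icc (-r + ∫ ω', X i ω' ∂P) (r + ∫ ω', X i ω' ∂P) := by
        filter_upwards [hb i hi] with ω hω
        have := abs_le.1 hω
        constructor <;> linarith
      have := hasSubgaussianMGF_of_mem_Icc (hmeas i).aemeasurable hXb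
      simpa using this
    have hc : ((((‖r - (-r)‖₊ / 2) ^ 2 : NNReal)) : ℝ) = r ^ 2 := by
      push_cast
      rw [Real.norm_eq_abs, div_pow, sq_abs]; ring
    have hind' : iIndepFun (fun i ω => X i ω - ∫ ω', X i ω' ∂P) P :=
      hind.comp (fun i x => x - ∫ ω', X i ω' ∂P) (fun i => by fun_prop)
    have hind'' : iIndepFun (fun i ω => -(X i ω - ∫ ω', X i ω' ∂P)) P :=
      hind.comp (fun i x => -(x - ∫ ω', X i ω' ∂P)) (fun i => by fun_prop)
    have hsub' : ∀ i ∈ s, HasSubgaussianMGF (fun ω => -(X i ω - ∫ ω', X i ω' ∂P))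
        ((‖r - (-r)‖₊ / 2) ^ 2) P := fun i hi => (hsub i hi).neg
    have hε0 : 0 ≤ ε := Real.sqrt_nonneg _
    have h1 := HasSubgaussianMGF.measure_sum_ge_le_of_iIndepFun hind' hsub hε0
    have h2 := HasSubgaussianMGF.measure_sum_ge_le_of_iIndepFun hind'' hsub' hε0
    have he : -ε ^ 2 / (2 * ∑ i ∈ s, ((((‖r - (-r)‖₊ / 2) ^ 2 : NNReal)) : ℝ)) = -l := by
      rw [Finset.sum_const, hc, nsmul_eq_mul, hε, Real.sq_sqrt (by positivity)]
      have : 2 * (s.card : ℝ) * r ^ 2 * l = l * (2 * (s.card * r ^ 2)) := by ring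
      rw [this, neg_div, mul_div_assoc, div_self (by positivity), mul_one]
    rw [NNReal.coe_sum] at h1 h2
    rw [he] at h1 h2
    have hsubset : {ω | ε < |∑ i ∈ s, (X i ω - ∫ ω', X i ω' ∂P)|} ⊆
        {ω | ε ≤ ∑ i ∈ s, (X i ω - ∫ ω', X i ω' ∂P)} ∪
        {ω | ε ≤ ∑ i ∈ s, -(X i ω - ∫ ω', X i ω' ∂P)} := by
      intro ω hω
      simp only [Set.mem_ofPred_eq] at hω
      rcases lt_abs.1 hω with h | h
      · exact Or.inl h.le
      · right
        simp only [Set.mem_ofPred_eq, Finset.sum_neg_distrib]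
        exact h.le
    calc _ ≤ _ := measureReal_mono hsubset
      _ ≤ _ := measureReal_union_le _ _
      _ ≤ _ := by linarith

/-- Comparison with a Poisson variable of the same mean: `1 + y ≤ exp y` at `y = p * (exp u - 1)`.
-/
theorem mgf_indicator_le {Ω α : Type*} [MeasurableSpace Ω] [MeasurableSpace α] {P : Measure Ω}
    [IsProbabilityMeasure P] {Y : Ω → α} (hY : Measurable Y) {A : Set α} (hA : MeasurableSet A)
    (u : ℝ) :
    mgf (fun ω => A.indicator (fun _ => (1 : ℝ)) (Y ω)) P u
      ≤ Real.exp (P.real {ω | Y ω ∈ A} * (Real.exp u - 1)) := by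
  have hm : MeasurableSet {ω | Y ω ∈ A} := hY hA
  have heq : (fun ω => Real.exp (u * A.indicator (fun _ => (1 : ℝ)) (Y ω))) =
      fun ω => 1 + ({ω | Y ω ∈ A}.indicator (fun _ => Real.exp u - 1)) ω := by
    funext ω
    by_cases h : Y ω ∈ A
    · simp [h]
    · simp [h]
  rw [mgf, heq, integral_add (integrable_const _) ((integrable_const _).indicator hm),
    integral_indicator_const _ hm]
  simp only [integral_const, probReal_univ, smul_eq_mul, mul_one]
  linarith [Real.add_one_le_exp (P.real {ω | Y ω ∈ A} * (Real.exp u - 1))]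

/-- The Poisson Chernoff exponent at the optimal tilt `log (1 + c / η)`, simplified by `log (1 + y)
≥ 2y / (y + 2)`. This form of the bound makes `confP` the root of a quadratic equation. -/
theorem poisson_exponent_le {η c : ℝ} (hη : 0 < η) (hc : 0 < c) :
    η * ((1 + c / η) - 1) - Real.log (1 + c / η) * (η + c) ≤ -c ^ 2 / (2 * η + c) := by
  have h := Real.le_log_one_add_of_nonneg (x := c / η) (by positivity)
  have h2 : 2 * (c / η) / (c / η + 2) * (η + c) ≤ Real.log (1 + c / η) * (η + c) := by gcongr
  have h3 : η * ((1 + c / η) - 1) - 2 * (c / η) / (c / η + 2) * (η + c)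
      = -c ^ 2 / (2 * η + c) := by
    field_simp
    ring
  linarith

/-- Multiplicative Chernoff bound for a sum of independent indicators. -/
theorem measureReal_chernoff_le {Ω ι α : Type*} [MeasurableSpace Ω] [MeasurableSpace α]
    {P : Measure Ω} [IsProbabilityMeasure P] {Y : ι → Ω → α} (hind : iIndepFun Y P)
    (hmeas : ∀ i, Measurable (Y i)) {A : ι → Set α} (hA : ∀ i, MeasurableSet (A i))
    (s : Finset ι) {c : ℝ} (hc : 0 < c) :
    P.real {ω | ∑ i ∈ s, P.real {ω | Y i ω ∈ A i} + c <
        ∑ i ∈ s, (A i).indicator (fun _ => (1 : ℝ)) (Y i ω)}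
      ≤ Real.exp (-c ^ 2 / (2 * ∑ i ∈ s, P.real {ω | Y i ω ∈ A i} + c)) := by
  set η := ∑ i ∈ s, P.real {ω | Y i ω ∈ A i} with hη
  have hη0 : 0 ≤ η := Finset.sum_nonneg fun i _ => measureReal_nonneg
  -- For mean zero there is no optimal tilt, but every indicator vanishes almost surely.
  rcases hη0.eq_or_lt with h0 | hpos
  · have hz : ∀ i ∈ s, P {ω | Y i ω ∈ A i} = 0 := by
      intro i hi
      have := (Finset.sum_eq_zero_iff_of_nonneg (fun i _ => measureReal_nonneg)).1 h0.symm i hi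
      exact (measureReal_eq_zero_iff).1 this
    have hnull : P {ω | η + c < ∑ i ∈ s, (A i).indicator (fun _ => (1 : ℝ)) (Y i ω)} = 0 := by
      refine measure_mono_null (t := ⋃ i ∈ s, {ω | Y i ω ∈ A i}) ?_
        ((measure_biUnion_null_iff s.countable_toSet).2 hz)
      intro ω hω
      by_contra hcon
      simp only [Set.mem_iUnion, Set.mem_ofPred_eq, not_exists] at hcon
      have : ∑ i ∈ s, (A i).indicator (fun _ => (1 : ℝ)) (Y i ω) = 0 :=
        Finset.sum_eq_zero fun i hi => Set.indicator_of_notMem (hcon i hi) _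
      simp only [Set.mem_ofPred_eq, this] at hω
      linarith
    rw [measureReal_def, hnull]
    simpa using (Real.exp_pos _).le
  · set Z : ι → Ω → ℝ := fun i ω => (A i).indicator (fun _ => (1 : ℝ)) (Y i ω) with hZ
    have hZm : ∀ i, Measurable (Z i) := fun i =>
      (measurable_const.indicator (hA i)).comp (hmeas i)
    have hZind : iIndepFun Z P :=
      hind.comp (fun i => (A i).indicator (fun _ => (1 : ℝ)))
        (fun i => measurable_const.indicator (hA i))
    set u := Real.log (1 + c / η) with hu
    have hu0 : 0 ≤ u := Real.log_nonneg (by linarith [div_pos hc hpos])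
    have hexp : Real.exp u = 1 + c / η := Real.exp_log (by positivity)
    have hint : Integrable (fun ω => Real.exp (u * (∑ i ∈ s, Z i) ω)) P := by
      refine hZind.integrable_exp_mul_sum hZm fun i _ => ?_
      refine integrable_exp_mul_of_mem_Icc (a := 0) (b := 1) (hZm i).aemeasurable
        (ae_of_all _ fun ω => ?_)
      simp only [hZ, Set.indicator]
      split_ifs <;> simp
    have h1 := measure_ge_le_exp_mul_mgf (μ := P) (X := ∑ i ∈ s, Z i) (η + c) hu0 hint
    rw [hZind.mgf_sum hZm] at h1
    have h2 : ∏ i ∈ s, mgf (Z i) P u ≤ Real.exp (η * (Real.exp u - 1)) := by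
      rw [hη, Finset.sum_mul, Real.exp_sum]
      exact Finset.prod_le_prod (fun i _ => mgf_nonneg)
        fun i _ => mgf_indicator_le (hmeas i) (hA i) u
    calc _ ≤ P.real {ω | η + c ≤ (∑ i ∈ s, Z i) ω} := by
          refine measureReal_mono fun ω hω => ?_
          simp only [Set.mem_ofPred_eq, Finset.sum_apply]
          exact le_of_lt hω
      _ ≤ _ := h1
      _ ≤ Real.exp (-u * (η + c)) * Real.exp (η * (Real.exp u - 1)) := by gcongr
      _ = Real.exp (η * ((1 + c / η) - 1) - u * (η + c)) := by
          rw [← Real.exp_add, hexp]; ring_nf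
      _ ≤ _ := Real.exp_le_exp.2 (poisson_exponent_le hpos hc)

/-! ### Handing out units in the order of the schedule. -/

namespace PerishingInstance

section Basic

variable {Ω Θ : Type*} (I : PerishingInstance Ω Θ)

theorem filter_lt_succ_of_lt {k : ℕ} (hk : k < I.B) :
    (Finset.univ.filter fun b => (I.σ b : ℕ) < k + 1) =
      insert (I.σ.symm ⟨k, hk⟩) (Finset.univ.filter fun b => (I.σ b : ℕ) < k) := by
  ext b
  simp only [Finset.mem_filter, Finset.mem_univ, true_and, Finset.mem_insert,
    Equiv.eq_symm_apply, Fin.ext_iff]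
  omega

/-- Induction along the schedule: the next unit supplies exactly what the prefix before it could
not, up to its own quantity. -/
theorem sum_handOut_prefix {q : Fin I.B → ℝ} (hq : ∀ b, 0 ≤ q b) {a : ℝ} (ha : 0 ≤ a) (k : ℕ) :
    ∑ b with (I.σ b : ℕ) < k, I.handOut q a b = min (∑ b with (I.σ b : ℕ) < k, q b) a := by
  induction k with
  | zero => simp [ha]
  | succ k ih =>
    by_cases hk : k < I.B
    · rw [I.filter_lt_succ_of_lt hk, Finset.sum_insert (by simp), Finset.sum_insert (by simp), ih]
      have h0 := hq (I.σ.symm ⟨k, hk⟩)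
      have hS : ∑ b' with I.σ b' < I.σ (I.σ.symm ⟨k, hk⟩), q b' =
          ∑ b with (I.σ b : ℕ) < k, q b := by
        simp [Fin.lt_def]
      rw [handOut, hS]
      set S := ∑ b with (I.σ b : ℕ) < k, q b
      set y := q (I.σ.symm ⟨k, hk⟩)
      simp only [min_def, max_def]
      split_ifs <;> linarith
    · have : (Finset.univ.filter fun b => (I.σ b : ℕ) < k + 1) =
          Finset.univ.filter fun b => (I.σ b : ℕ) < k := by
        ext b
        have := (I.σ b).isLt
        simp only [Finset.mem_filter, Finset.mem_univ, true_and]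
        omega
      rw [this, ih]

theorem sum_handOut {q : Fin I.B → ℝ} (hq : ∀ b, 0 ≤ q b) {a : ℝ} (ha : 0 ≤ a)
    (haq : a ≤ ∑ b, q b) : ∑ b, I.handOut q a b = a := by
  have h := I.sum_handOut_prefix hq ha I.B
  have hu : (Finset.univ.filter fun b => (I.σ b : ℕ) < I.B) = Finset.univ := by
    ext b; simp
  rw [hu] at h
  rw [h, min_eq_right haq]

theorem handOut_nonneg {q : Fin I.B → ℝ} (hq : ∀ b, 0 ≤ q b) (a : ℝ) (b : Fin I.B) :
    0 ≤ I.handOut q a b :=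
  le_min (hq b) (le_max_left _ _)

theorem handOut_le (q : Fin I.B → ℝ) (a : ℝ) (b : Fin I.B) : I.handOut q a b ≤ q b :=
  min_le_left _ _

/-- If a unit is not exhausted, then everything was taken from the units up to it. -/
theorem sum_handOut_of_lt {q : Fin I.B → ℝ} (hq : ∀ b, 0 ≤ q b) {a : ℝ} (ha : 0 ≤ a)
    {b : Fin I.B} (hb : I.handOut q a b < q b) :
    ∑ b' with (I.σ b' : ℕ) < I.σ b + 1, I.handOut q a b' = a := by
  rw [I.sum_handOut_prefix hq ha]
  refine min_eq_right ?_
  have hins := I.filter_lt_succ_of_lt (I.σ b).isLt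
  rw [hins, Finset.sum_insert (by simp)]
  have hb' : max 0 (a - ∑ b' with I.σ b' < I.σ b, q b') < q b := by
    by_contra h
    exact absurd hb (by rw [handOut, min_eq_left (not_lt.1 h)]; exact lt_irrefl _)
  have := (max_lt_iff.1 hb').2
  simp only [Fin.lt_def] at this
  simp only [Fin.eta, Equiv.symm_apply_apply]
  linarith

theorem arrivals_nonneg [Fintype Θ] (ω : Ω) (t : ℕ) : 0 ≤ I.arrivals ω t :=
  Finset.sum_nonneg fun _ _ => Nat.cast_nonneg _

variable {I} in
theorem half_lt_log_T (hT : 2 ≤ I.T) : 1 / 2 < Real.log I.T := by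
  have h2 : (2 : ℝ) ≤ I.T := by exact_mod_cast hT
  have := Real.log_le_log (by norm_num) h2
  linarith [Real.log_two_gt_d9]

end Basic

variable {Ω Θ : Type*} [MeasurableSpace Ω] [Fintype Θ]
variable (I : PerishingInstance Ω Θ) (P : Measure Ω) (δ L : ℝ) (ω : Ω)

/-! ### Elementary bounds on the confidence terms -/

theorem meanArrivals_nonneg (t : ℕ) : 0 ≤ I.meanArrivals P t :=
  Finset.sum_nonneg fun _ _ => integral_nonneg fun _ => Nat.cast_nonneg _

theorem meanIoc_nonneg (s t : ℕ) : 0 ≤ I.meanIoc P s t :=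
  Finset.sum_nonneg fun _ _ => I.meanArrivals_nonneg P _

theorem confN_nonneg (s t : ℕ) : 0 ≤ I.confN P δ s t := Real.sqrt_nonneg _

theorem confN_self (t : ℕ) : I.confN P δ t t = 0 := by simp [confN]

theorem meanIoc_self (t : ℕ) : I.meanIoc P t t = 0 := by simp [meanIoc]

theorem upperN_nonneg (t : ℕ) : 0 ≤ I.upperN P δ t :=
  add_nonneg (I.meanIoc_nonneg P _ _) (I.confN_nonneg P δ _ _)

theorem eta_nonneg (t : ℕ) : 0 ≤ I.eta P δ t :=
  Finset.sum_nonneg fun _ _ => measureReal_nonneg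

theorem spoilMean_nonneg (X : ℝ) : 0 ≤ I.spoilMean P δ X :=
  Finset.sum_nonneg fun _ _ => measureReal_nonneg

/-- the logarithmic factor in `Conf^P_t` -/
noncomputable def logConf (t : ℕ) : ℝ := Real.log (3 * t * Real.log I.T / δ)

variable {I P δ L ω}

theorem logConf_pos (hT : 2 ≤ I.T) (hδ : 0 < δ) (hδ1 : δ < 1) {t : ℕ} (ht : 1 ≤ t) :
    0 < I.logConf δ t := by
  have h1 := half_lt_log_T hT
  have h2 : (1 : ℝ) ≤ t := by exact_mod_cast ht
  refine Real.log_pos ?_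
  rw [lt_div_iff₀ hδ]
  nlinarith

theorem confP_pos (hT : 2 ≤ I.T) (hδ : 0 < δ) (hδ1 : δ < 1) {t : ℕ} (ht : 1 ≤ t) (x : ℝ) :
    0 < I.confP δ t x := by
  have h := logConf_pos hT hδ hδ1 ht
  have h2 := Real.sqrt_nonneg (I.logConf δ t ^ 2 + 8 * x * I.logConf δ t)
  rw [logConf] at h h2
  rw [confP]
  linarith

theorem confP_mono (hT : 2 ≤ I.T) (hδ : 0 < δ) (hδ1 : δ < 1) {t : ℕ} (ht : 1 ≤ t) {x y : ℝ}
    (hxy : x ≤ y) : I.confP δ t x ≤ I.confP δ t y := by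
  have h := logConf_pos hT hδ hδ1 ht
  rw [logConf] at h
  rw [confP, confP]
  gcongr

/-- The defining quadratic equation of `Conf^P_t`. -/
theorem confP_sq (hT : 2 ≤ I.T) (hδ : 0 < δ) (hδ1 : δ < 1) {t : ℕ} (ht : 1 ≤ t) {x : ℝ}
    (hx : 0 ≤ x) : I.confP δ t x ^ 2 = I.logConf δ t * (2 * x + I.confP δ t x) := by
  have h := logConf_pos hT hδ hδ1 ht
  have hs := Real.sq_sqrt (show 0 ≤ I.logConf δ t ^ 2 + 8 * x * I.logConf δ t by positivity)
  have hc : I.confP δ t x = (1 / 2) * (I.logConf δ t +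
    √(I.logConf δ t ^ 2 + 8 * x * I.logConf δ t)) := rfl
  rw [hc]
  linear_combination (1 / 4) * hs

theorem forecast_nonneg (hT : 2 ≤ I.T) (hδ : 0 < δ) (hδ1 : δ < 1) (t : ℕ) :
    0 ≤ I.forecast P δ t := by
  induction t with
  | zero => simp [forecast]
  | succ t ih =>
    exact le_min ih (add_nonneg (I.eta_nonneg P δ _)
      (confP_pos hT hδ hδ1 (Nat.le_add_left 1 t) _).le)

theorem forecast_antitone : Antitone (I.forecast P δ) :=
  antitone_nat_of_succ_le fun _ => min_le_left _ _

theorem worstLoss_nonneg (hT : 2 ≤ I.T) (hδ : 0 < δ) (hδ1 : δ < 1) (X : ℝ) :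
    0 ≤ I.worstLoss P δ X :=
  le_min (Nat.cast_nonneg _) (add_nonneg (I.spoilMean_nonneg P δ _)
    (confP_pos hT hδ hδ1 le_rfl _).le)

/-! ### The lower guardrail as a fixed point -/

theorem latestTime_antitone {X Y : ℝ} (hX : 0 ≤ X) (hXY : X ≤ Y) (b : Fin I.B) :
    I.latestTime P δ Y 1 b ≤ I.latestTime P δ X 1 b := by
  refine le_iInf₂ fun t' ht' => iInf₂_le t' ⟨ht'.1, ht'.2.1, ?_⟩
  have h0 : I.lowerN P δ 0 (1 - 1) = 0 := by simp [lowerN, confN_self, meanIoc_self]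
  have h := ht'.2.2
  rw [h0, zero_mul, zero_add] at h ⊢
  -- `lowerN` can be negative when the confidence radius exceeds the mean; but a rank is at least
  -- `1`, so it is not negative at a time when the slow process has reached `b`.
  have hr : (1 : ℝ) ≤ I.rank b := by simp [rank]
  have hl : 0 ≤ I.lowerN P δ (1 - 1) t' := by
    by_contra hneg
    push Not at hneg
    nlinarith
  exact h.trans (mul_le_mul_of_nonneg_left hXY hl)

theorem spoilMean_antitone [IsProbabilityMeasure P] {X Y : ℝ} (hX : 0 ≤ X) (hXY : X ≤ Y) :
    I.spoilMean P δ Y ≤ I.spoilMean P δ X := by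
  refine Finset.sum_le_sum fun b _ => measureReal_mono fun ω hω => ?_
  exact lt_of_lt_of_le hω (min_le_min le_rfl (latestTime_antitone hX hXY b))

theorem worstLoss_antitone [IsProbabilityMeasure P] (hT : 2 ≤ I.T) (hδ : 0 < δ) (hδ1 : δ < 1)
    {X Y : ℝ} (hX : 0 ≤ X) (hXY : X ≤ Y) : I.worstLoss P δ Y ≤ I.worstLoss P δ X :=
  min_le_min le_rfl (add_le_add (spoilMean_antitone hX hXY)
    (confP_mono hT hδ hδ1 le_rfl (spoilMean_antitone hX hXY)))

/-- Knaster–Tarski argument: a larger allocation consumes units earlier and loses less, so the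
right-hand side is monotone in the allocation. The supremum of its post-fixed points is then a fixed
point, without any continuity. -/
theorem lowerX_fixed [IsProbabilityMeasure P] (hT : 2 ≤ I.T) (hδ : 0 < δ) (hδ1 : δ < 1) :
    0 ≤ I.lowerX P δ ∧
      I.lowerX P δ = ((I.B : ℝ) - I.worstLoss P δ (I.lowerX P δ)) / I.upperN P δ 0 := by
  set S := {X : ℝ | 0 ≤ X ∧ X ≤ ((I.B : ℝ) - I.worstLoss P δ X) / I.upperN P δ 0} with hS
  have hU := I.upperN_nonneg P δ 0
  have hBW : ∀ X, 0 ≤ (I.B : ℝ) - I.worstLoss P δ X := fun X =>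
    sub_nonneg.2 (min_le_left _ _)
  have h0 : (0 : ℝ) ∈ S := ⟨le_rfl, div_nonneg (hBW 0) hU⟩
  have hbdd : BddAbove S := ⟨(I.B : ℝ) / I.upperN P δ 0, fun X hX => hX.2.trans
    (div_le_div_of_nonneg_right (sub_le_self _ (worstLoss_nonneg hT hδ hδ1 X)) hU)⟩
  have hx0 : 0 ≤ I.lowerX P δ := le_csSup hbdd h0
  have hg : ∀ {X Y : ℝ}, 0 ≤ X → X ≤ Y → ((I.B : ℝ) - I.worstLoss P δ X) / I.upperN P δ 0 ≤
      ((I.B : ℝ) - I.worstLoss P δ Y) / I.upperN P δ 0 := fun hX hXY =>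
    div_le_div_of_nonneg_right (sub_le_sub_left (worstLoss_antitone hT hδ hδ1 hX hXY) _) hU
  have hle : I.lowerX P δ ≤ ((I.B : ℝ) - I.worstLoss P δ (I.lowerX P δ)) / I.upperN P δ 0 :=
    csSup_le ⟨0, h0⟩ fun X hX => hX.2.trans (hg hX.1 (le_csSup hbdd hX))
  refine ⟨hx0, le_antisymm hle (le_csSup hbdd ⟨hx0.trans hle, hg hx0 hle⟩)⟩

end PerishingInstance

namespace PerishingInstance

variable {Ω Θ : Type*} [MeasurableSpace Ω] [Fintype Θ]

/-! ### The stock process -/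

section Trajectory

variable (I : PerishingInstance Ω Θ) (P : Measure Ω) (δ L : ℝ) (ω : Ω)

/-- the total quantity allocated in round `t` -/
noncomputable def spend (t : ℕ) : ℝ := I.arrivals ω t * I.alloc P δ L ω t

/-- the total quantity allocated in rounds `1, …, t` -/
noncomputable def used (t : ℕ) : ℝ := ∑ r ∈ Finset.Icc 1 t, I.spend P δ L ω r

/-- what is left of a unit after the allocation of round `t` and before perishing -/
noncomputable def residual (t : ℕ) (b : Fin I.B) : ℝ :=
  I.stock P δ L ω (t - 1) b - I.handOut (I.stock P δ L ω (t - 1)) (I.spend P δ L ω t) b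

/-- the quantity that perishes at the end of round `t` -/
noncomputable def lost (t : ℕ) : ℝ :=
  ∑ b, if I.perishTime b ω = t then I.residual P δ L ω t b else 0

/-- the perishing times of `b` that count as spoilage in the forecast of round `t` -/
def spoilSet (t : ℕ) (b : Fin I.B) : Set ℕ :=
  {m | t ≤ m ∧ (m : ℕ∞) < min (I.T : ℕ∞) (I.latestTime P δ (I.lowerX P δ) t b)}

/-- the number of units whose perishing the forecast of round `t` has to cover -/
noncomputable def spoilCount (t : ℕ) : ℝ :=
  ∑ b ∈ I.slowRemaining P δ t, (I.spoilSet P δ t b).indicator (fun _ => (1 : ℝ)) (I.perishTime b ω)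

end Trajectory

variable {I : PerishingInstance Ω Θ} {P : Measure Ω} {δ L : ℝ} {ω : Ω}

theorem stock_succ (t : ℕ) (b : Fin I.B) : I.stock P δ L ω (t + 1) b =
    if I.perishTime b ω = t + 1 then 0 else I.residual P δ L ω (t + 1) b := rfl

theorem used_succ (t : ℕ) :
    I.used P δ L ω (t + 1) = I.used P δ L ω t + I.spend P δ L ω (t + 1) :=
  Finset.sum_Icc_succ_top (Nat.le_add_left 1 t) _

theorem stock_mem (t : ℕ) (b : Fin I.B) :
    0 ≤ I.stock P δ L ω t b ∧ I.stock P δ L ω t b ≤ 1 := by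
  induction t with
  | zero => exact ⟨zero_le_one, le_rfl⟩
  | succ t ih =>
    rw [stock_succ]
    split_ifs
    · exact ⟨le_rfl, zero_le_one⟩
    · have h1 : I.handOut (I.stock P δ L ω t) (I.spend P δ L ω (t + 1)) b ≤ I.stock P δ L ω t b :=
        I.handOut_le _ _ b
      have h2 : 0 ≤ I.handOut (I.stock P δ L ω t) (I.spend P δ L ω (t + 1)) b := by
        refine le_min ih.1 (le_max_left _ _)
      have h3 : I.residual P δ L ω (t + 1) b = I.stock P δ L ω t b -
        I.handOut (I.stock P δ L ω t) (I.spend P δ L ω (t + 1)) b := rfl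
      constructor <;> linarith

theorem budget_nonneg (t : ℕ) : 0 ≤ I.budget P δ L ω t :=
  Finset.sum_nonneg fun _ _ => (stock_mem _ _).1

theorem residual_mem (t : ℕ) (b : Fin I.B) :
    0 ≤ I.residual P δ L ω t b ∧ I.residual P δ L ω t b ≤ 1 := by
  have h1 := stock_mem (P := P) (δ := δ) (L := L) (ω := ω) (t - 1) b
  have h2 := I.handOut_le (I.stock P δ L ω (t - 1)) (I.spend P δ L ω t) b
  have h3 := I.handOut_nonneg (fun b => (stock_mem (P := P) (δ := δ) (L := L) (ω := ω) (t - 1) b).1)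
    (I.spend P δ L ω t) b
  rw [residual]
  constructor <;> linarith

theorem lost_nonneg (t : ℕ) : 0 ≤ I.lost P δ L ω t := by
  refine Finset.sum_nonneg fun b _ => ?_
  split_ifs
  · exact (residual_mem t b).1
  · exact le_rfl

section

variable (hx : 0 ≤ I.lowerX P δ) (hL : 0 ≤ L) (hF : ∀ t, 0 ≤ I.forecast P δ t)
include hx hL hF

theorem rule_spec (t : ℕ) {β : ℝ} (hβ : 0 ≤ β) :
    0 ≤ I.arrivals ω t * I.rule P δ L ω t β ∧ I.arrivals ω t * I.rule P δ L ω t β ≤ β := by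
  have hn := I.arrivals_nonneg ω t
  rw [rule]
  split_ifs with h1 h2
  -- Division is safe: without arrivals this branch would require a negative budget.
  · have hn0 : I.arrivals ω t ≠ 0 := by
      intro h
      rw [h, zero_mul] at h1
      exact absurd h1 (not_lt.2 hβ)
    rw [mul_div_cancel₀ _ hn0]
    exact ⟨hβ, le_rfl⟩
  · have := mul_nonneg hx (I.upperN_nonneg P δ t)
    have := hF t
    exact ⟨by positivity, by linarith⟩
  · exact ⟨by positivity, not_lt.1 h1⟩

theorem spend_mem (t : ℕ) :
    0 ≤ I.spend P δ L ω t ∧ I.spend P δ L ω t ≤ I.budget P δ L ω t :=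
  rule_spec hx hL hF t (budget_nonneg t)

theorem used_mono {s t : ℕ} (hst : s ≤ t) : I.used P δ L ω s ≤ I.used P δ L ω t :=
  Finset.sum_le_sum_of_subset_of_nonneg (Finset.Icc_subset_Icc_right hst)
    fun r _ _ => (spend_mem hx hL hF r).1

/-- The budget of the next round is what is left after allocation and perishing. -/
theorem budget_succ (t : ℕ) : I.budget P δ L ω (t + 2) =
    I.budget P δ L ω (t + 1) - I.spend P δ L ω (t + 1) - I.lost P δ L ω (t + 1) := by
  have hs := spend_mem hx hL hF (ω := ω) (t + 1)
  have h1 := I.sum_handOut (fun b => (stock_mem (P := P) (δ := δ) (L := L) (ω := ω) t b).1) hs.1 hs.2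
  have h2 : ∑ b, I.residual P δ L ω (t + 1) b =
      I.budget P δ L ω (t + 1) - I.spend P δ L ω (t + 1) := by
    simp only [residual, Finset.sum_sub_distrib, Nat.add_sub_cancel]
    rw [h1]; rfl
  rw [← h2, lost, ← Finset.sum_sub_distrib]
  refine Finset.sum_congr rfl fun b _ => ?_
  change I.stock P δ L ω (t + 1) b = _
  rw [stock_succ]
  split_ifs <;> simp

/-- Units are consumed in order of rank, so as long as `b` is not exhausted everything used came
from the units up to `b`, which initially hold `rank b`. Perishing only decreases the left-hand
side. -/
theorem stock_invariant (t : ℕ) (b : Fin I.B) (hb : 0 < I.stock P δ L ω t b) :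
    I.used P δ L ω t + ∑ b' with (I.σ b' : ℕ) < I.σ b + 1, I.stock P δ L ω t b' ≤ I.rank b := by
  induction t with
  | zero =>
    have h1 : (Finset.univ.filter fun b' => (I.σ b' : ℕ) < I.σ b + 1).card ≤ (I.σ b : ℕ) + 1 := by
      calc _ ≤ (Finset.range ((I.σ b : ℕ) + 1)).card := by
            refine Finset.card_le_card_of_injOn (fun b' => (I.σ b' : ℕ)) ?_ ?_
            · intro b' hb'
              simpa using hb'
            · intro b₁ _ b₂ _ h
              exact I.σ.injective (Fin.ext h)
        _ = _ := Finset.card_range _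
    simp only [used, stock, rank, Finset.sum_const, nsmul_eq_mul, mul_one, zero_add,
      Finset.Icc_eq_empty_of_lt (Nat.zero_lt_one),
      Finset.sum_empty]
    exact_mod_cast h1
  | succ t ih =>
    have hres : 0 < I.residual P δ L ω (t + 1) b := by
      rw [stock_succ] at hb
      split_ifs at hb with h
      · exact absurd hb (lt_irrefl _)
      · exact hb
    have hle : ∀ b', I.stock P δ L ω (t + 1) b' ≤ I.residual P δ L ω (t + 1) b' := by
      intro b'
      rw [stock_succ]
      split_ifs
      · exact (residual_mem _ _).1
      · exact le_rfl
    have hlt : I.handOut (I.stock P δ L ω t) (I.spend P δ L ω (t + 1)) b < I.stock P δ L ω t b :=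
      sub_pos.1 hres
    have hsum := I.sum_handOut_of_lt (fun b => (stock_mem (P := P) (δ := δ) (L := L) (ω := ω) t b).1)
      (spend_mem hx hL hF (ω := ω) (t + 1)).1 hlt
    have hpos : 0 < I.stock P δ L ω t b :=
      (I.handOut_nonneg (fun b => (stock_mem (P := P) (δ := δ) (L := L) (ω := ω) t b).1) _ b).trans_lt hlt
    have hS : ∑ b' with (I.σ b' : ℕ) < I.σ b + 1, I.stock P δ L ω (t + 1) b' ≤
        ∑ b' with (I.σ b' : ℕ) < I.σ b + 1, I.residual P δ L ω (t + 1) b' :=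
      Finset.sum_le_sum fun b' _ => hle b'
    simp only [residual, Finset.sum_sub_distrib, Nat.add_sub_cancel, hsum] at hS
    have := ih hpos
    rw [used_succ]
    linarith

/-- A unit with something left after the allocation of a round has larger rank than the quantity
used so far. -/
theorem used_lt_rank_of_residual {t : ℕ} {b : Fin I.B}
    (hb : 0 < I.residual P δ L ω (t + 1) b) : I.used P δ L ω (t + 1) < I.rank b := by
  have hlt : I.handOut (I.stock P δ L ω t) (I.spend P δ L ω (t + 1)) b < I.stock P δ L ω t b :=
    sub_pos.1 hb
  have hq := fun b => (stock_mem (I := I) (P := P) (δ := δ) (L := L) (ω := ω) t b).1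
  have hsum := I.sum_handOut_of_lt hq (spend_mem hx hL hF (ω := ω) (t + 1)).1 hlt
  have hpos : 0 < I.stock P δ L ω t b := (I.handOut_nonneg hq _ b).trans_lt hlt
  have h := stock_invariant hx hL hF t b hpos
  have h1 : I.residual P δ L ω (t + 1) b ≤
      ∑ b' with (I.σ b' : ℕ) < I.σ b + 1, I.residual P δ L ω (t + 1) b' :=
    Finset.single_le_sum (f := fun b' => I.residual P δ L ω (t + 1) b')
      (fun b' _ => (residual_mem (t + 1) b').1) (by simp)
  have h2 : ∑ b' with (I.σ b' : ℕ) < I.σ b + 1, I.residual P δ L ω (t + 1) b' =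
      ∑ b' with (I.σ b' : ℕ) < I.σ b + 1, I.stock P δ L ω t b' - I.spend P δ L ω (t + 1) := by
    simp only [residual, Finset.sum_sub_distrib, Nat.add_sub_cancel, hsum]
  rw [used_succ]
  linarith

/-- A unit is lost only at its perishing time, with quantity at most `1`, and only if the allocation
of that round leaves some of it; `used_lt_rank_of_residual` then compares its rank with consumption.
-/
theorem sum_lost_le_card {s t : ℕ} (hs : 1 ≤ s) :
    ∑ r ∈ Finset.Icc s t, I.lost P δ L ω r ≤
      ∑ b, if I.perishTime b ω ∈ Finset.Icc s t ∧
        I.used P δ L ω (I.perishTime b ω) < I.rank b then 1 else 0 := by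
  simp only [lost]
  rw [Finset.sum_comm]
  refine Finset.sum_le_sum fun b _ => ?_
  rw [Finset.sum_ite_eq]
  by_cases hm : I.perishTime b ω ∈ Finset.Icc s t
  · rw [if_pos hm]
    have hr := residual_mem (P := P) (δ := δ) (L := L) (ω := ω) (I.perishTime b ω) b
    by_cases hu : I.used P δ L ω (I.perishTime b ω) < I.rank b
    · rw [if_pos ⟨hm, hu⟩]
      exact hr.2
    · rw [if_neg (fun h => hu h.2)]
      by_contra hpos
      push Not at hpos
      obtain ⟨k, hk⟩ : ∃ k, I.perishTime b ω = k + 1 :=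
        Nat.exists_eq_add_of_le' (hs.trans (Finset.mem_Icc.1 hm).1)
      rw [hk] at hpos hu
      exact hu (used_lt_rank_of_residual hx hL hF hpos)
  · rw [if_neg hm, if_neg (fun h => hm h.1)]

/-- If consumption is at least that of the slow process, the losses up to round `t` are covered by
the spoilage count. -/
theorem sum_lost_le_spoilCount
    (hN : ∀ s t, s ≤ t → t ≤ I.T → I.lowerN P δ s t ≤ ∑ r ∈ Finset.Ioc s t, I.arrivals ω r)
    {s t : ℕ} (hs : 1 ≤ s) (ht : t < I.T)
    (hslow : ∀ r ∈ Finset.Icc 1 t, I.arrivals ω r * I.lowerX P δ ≤ I.spend P δ L ω r) :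
    ∑ r ∈ Finset.Icc s t, I.lost P δ L ω r ≤ I.spoilCount P δ ω s := by
  refine (sum_lost_le_card hx hL hF hs).trans ?_
  have hused : ∀ m ≤ t, (∑ r ∈ Finset.Ioc 0 m, I.arrivals ω r) * I.lowerX P δ ≤
      I.used P δ L ω m := by
    intro m hm
    rw [Finset.sum_mul, used, show Finset.Ioc 0 m = Finset.Icc 1 m by ext; simp; omega]
    refine Finset.sum_le_sum fun r hr => hslow r ?_
    rw [Finset.mem_Icc] at hr ⊢
    omega
  -- A unit lost in rounds `s, …, t` is one that the forecast of round `s` counts: actual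
  -- consumption has not passed its rank, so neither has the slower process.
  have key : ∀ b, I.perishTime b ω ∈ Finset.Icc s t →
      I.used P δ L ω (I.perishTime b ω) < I.rank b →
      b ∈ I.slowRemaining P δ s ∧ I.perishTime b ω ∈ I.spoilSet P δ s b := by
    intro b hb hub
    rw [Finset.mem_Icc] at hb
    refine ⟨?_, hb.1, ?_⟩
    · simp only [slowRemaining, Finset.mem_filter, Finset.mem_univ, true_and]
      refine Int.ceil_le.2 ?_
      push_cast
      calc I.lowerN P δ 0 (s - 1) * I.lowerX P δ
          ≤ (∑ r ∈ Finset.Ioc 0 (s - 1), I.arrivals ω r) * I.lowerX P δ :=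
            mul_le_mul_of_nonneg_right (hN 0 (s - 1) (Nat.zero_le _) (by omega)) hx
        _ ≤ I.used P δ L ω (s - 1) := hused _ (by omega)
        _ ≤ I.used P δ L ω (I.perishTime b ω) := used_mono hx hL hF (by omega)
        _ ≤ _ := hub.le
    · refine lt_min (by exact_mod_cast hb.2.trans_lt ht) ?_
      -- If the slow process reached `b` at some `t'` no later than its perishing time, then actual
      -- consumption by that time would be at least the rank of `b`.
      refine lt_of_lt_of_le (b := ((I.perishTime b ω + 1 : ℕ) : ℕ∞))
        (by exact_mod_cast Nat.lt_succ_self _) (le_iInf₂ fun t' ht' => ?_)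
      rw [Nat.cast_le]
      by_contra hlt
      have hlt' : t' ≤ I.perishTime b ω := by omega
      have h1 := hN 0 (s - 1) (Nat.zero_le _) (by omega)
      have h2 := hN (s - 1) t' (by omega) ht'.2.1
      have h3 : ∑ r ∈ Finset.Ioc 0 (s - 1), I.arrivals ω r +
          ∑ r ∈ Finset.Ioc (s - 1) t', I.arrivals ω r = ∑ r ∈ Finset.Ioc 0 t', I.arrivals ω r :=
        Finset.sum_Ioc_consecutive _ (Nat.zero_le _) (by omega)
      have h4 := hused t' (by omega)
      have h5 : I.used P δ L ω t' ≤ I.used P δ L ω (I.perishTime b ω) :=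
        used_mono hx hL hF hlt'
      have h6 := ht'.2.2
      rw [← h3] at h4
      nlinarith
  rw [spoilCount, slowRemaining, Finset.sum_filter]
  refine Finset.sum_le_sum fun b _ => ?_
  by_cases hb : I.perishTime b ω ∈ Finset.Icc s t ∧ I.used P δ L ω (I.perishTime b ω) < I.rank b
  · obtain ⟨h1, h2⟩ := key b hb.1 hb.2
    have h1' : ⌈I.lowerN P δ 0 (s - 1) * I.lowerX P δ⌉ ≤ (I.rank b : ℤ) := by
      simpa [slowRemaining] using h1
    rw [if_pos hb, if_pos h1', Set.indicator_of_mem h2]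
  · rw [if_neg hb]
    split_ifs
    · exact Set.indicator_nonneg (fun _ _ => zero_le_one) _
    · exact le_rfl

end

end PerishingInstance

namespace PerishingInstance

variable {Ω Θ : Type*} [MeasurableSpace Ω] [Fintype Θ]

/-! ### The guardrails along a good sample path -/

/-- The sample paths on which all confidence bounds hold. -/
structure Good (I : PerishingInstance Ω Θ) (P : Measure Ω) (δ : ℝ) (ω : Ω) : Prop where
  one_le_N : ∀ t ∈ Finset.Icc 1 I.T, ∀ θ, 1 ≤ I.N t θ ω
  arrivals_close : ∀ s t, s ≤ t → t ≤ I.T →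
    |∑ r ∈ Finset.Ioc s t, I.arrivals ω r - I.meanIoc P s t| ≤ I.confN P δ s t
  spoilCount_le : ∀ t ∈ Finset.Icc 1 I.T,
    I.spoilCount P δ ω t ≤ I.eta P δ t + I.confP δ t (I.eta P δ t)

variable {I : PerishingInstance Ω Θ} {P : Measure Ω} {δ L : ℝ} {ω : Ω}

theorem Good.lowerN_le (h : I.Good P δ ω) (s t : ℕ) (hst : s ≤ t) (ht : t ≤ I.T) :
    I.lowerN P δ s t ≤ ∑ r ∈ Finset.Ioc s t, I.arrivals ω r := by
  have := (abs_le.1 (h.arrivals_close s t hst ht)).1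
  rw [lowerN]
  linarith

theorem Good.le_upperN (h : I.Good P δ ω) {s : ℕ} (hs : s ≤ I.T) :
    ∑ r ∈ Finset.Ioc s I.T, I.arrivals ω r ≤ I.upperN P δ s := by
  have := (abs_le.1 (h.arrivals_close s I.T hs le_rfl)).2
  rw [upperN]
  linarith

theorem Good.upperN_le (h : I.Good P δ ω) {s : ℕ} (hs : s ≤ I.T) :
    I.upperN P δ s ≤ ∑ r ∈ Finset.Ioc s I.T, I.arrivals ω r + 2 * I.confN P δ s I.T := by
  have := (abs_le.1 (h.arrivals_close s I.T hs le_rfl)).1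
  rw [upperN]
  linarith

theorem Good.one_le_arrivals [Nonempty Θ] (h : I.Good P δ ω) {t : ℕ}
    (ht : t ∈ Finset.Icc 1 I.T) : 1 ≤ I.arrivals ω t := by
  obtain ⟨θ⟩ := ‹Nonempty Θ›
  have h1 : (1 : ℝ) ≤ I.N t θ ω := by exact_mod_cast h.one_le_N t ht θ
  exact h1.trans (Finset.single_le_sum (f := fun θ => (I.N t θ ω : ℝ))
    (fun _ _ => Nat.cast_nonneg _) (Finset.mem_univ θ))

theorem Good.sub_le_sum_arrivals [Nonempty Θ] (h : I.Good P δ ω) {s : ℕ} (hs : s ≤ I.T) :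
    (I.T : ℝ) - s ≤ ∑ r ∈ Finset.Ioc s I.T, I.arrivals ω r := by
  have h1 : ∑ r ∈ Finset.Ioc s I.T, (1 : ℝ) ≤ ∑ r ∈ Finset.Ioc s I.T, I.arrivals ω r := by
    refine Finset.sum_le_sum fun r hr => h.one_le_arrivals ?_
    rw [Finset.mem_Ioc] at hr
    rw [Finset.mem_Icc]
    omega
  simpa [Nat.cast_sub hs] using h1

/-- Ties the algorithm's first forecast to the loss budgeted in the fixed-point equation, so that
the initial budget contains the reserve. -/
theorem forecast_one_le_worstLoss [IsProbabilityMeasure P] (hT : 2 ≤ I.T) (hδ : 0 < δ)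
    (hδ1 : δ < 1) : I.forecast P δ 1 ≤ I.worstLoss P δ (I.lowerX P δ) := by
  have heta : I.eta P δ 1 ≤ I.spoilMean P δ (I.lowerX P δ) := by
    refine (Finset.sum_le_sum_of_subset_of_nonneg (Finset.subset_univ _)
      fun _ _ _ => measureReal_nonneg).trans ?_
    exact Finset.sum_le_sum fun b _ => measureReal_mono fun ω hω => hω.2
  exact min_le_min le_rfl (add_le_add heta (confP_mono hT hδ hδ1 le_rfl heta))

/-- The forecast covers the future losses. -/
theorem Good.sum_lost_le_forecast (h : I.Good P δ ω) (hx : 0 ≤ I.lowerX P δ) (hL : 0 ≤ L)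
    (hF : ∀ t, 0 ≤ I.forecast P δ t) {t : ℕ} (ht : t < I.T)
    (hslow : ∀ r ∈ Finset.Icc 1 t, I.arrivals ω r * I.lowerX P δ ≤ I.spend P δ L ω r)
    {k s : ℕ} (hks : k ≤ s) (hs : 1 ≤ s) :
    ∑ r ∈ Finset.Icc s t, I.lost P δ L ω r ≤ I.forecast P δ k := by
  -- `forecast` is a running minimum: each earlier round `k ≤ s` gives its own bound on the losses
  -- from `s` on.
  induction k with
  | zero =>
    refine (sum_lost_le_card hx hL hF hs).trans ?_
    calc _ ≤ ∑ _b : Fin I.B, (1 : ℝ) := Finset.sum_le_sum fun b _ => by split_ifs <;> norm_num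
      _ = _ := by simp [forecast]
  | succ k ih =>
    by_cases hst : s ≤ t
    · refine le_min (ih (by omega)) ?_
      calc _ ≤ ∑ r ∈ Finset.Icc (k + 1) t, I.lost P δ L ω r :=
            Finset.sum_le_sum_of_subset_of_nonneg (Finset.Icc_subset_Icc_left hks)
              fun r _ _ => lost_nonneg r
        _ ≤ _ := sum_lost_le_spoilCount hx hL hF h.lowerN_le (Nat.le_add_left 1 k) ht hslow
        _ ≤ _ := h.spoilCount_le _ (Finset.mem_Icc.2 ⟨Nat.le_add_left 1 k, by omega⟩)
    · rw [Finset.Icc_eq_empty hst]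
      exact hF _

theorem alloc_cases {t : ℕ} (h : I.arrivals ω t * I.lowerX P δ ≤ I.budget P δ L ω t) :
    (I.alloc P δ L ω t = I.lowerX P δ + L ∧ I.lowerX P δ * I.upperN P δ t + I.forecast P δ t
      ≤ I.budget P δ L ω t - I.arrivals ω t * (I.lowerX P δ + L)) ∨
    (I.alloc P δ L ω t = I.lowerX P δ ∧ I.budget P δ L ω t - I.arrivals ω t * (I.lowerX P δ + L) <
      I.lowerX P δ * I.upperN P δ t + I.forecast P δ t) := by
  rw [alloc, rule, if_neg (not_lt.2 h)]
  split_ifs with h2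
  · exact Or.inl ⟨rfl, h2⟩
  · exact Or.inr ⟨rfl, not_le.1 h2⟩

theorem lowerX_mul_le_spend (hL : 0 ≤ L) {t : ℕ}
    (h : I.arrivals ω t * I.lowerX P δ ≤ I.budget P δ L ω t) :
    I.arrivals ω t * I.lowerX P δ ≤ I.spend P δ L ω t := by
  refine mul_le_mul_of_nonneg_left ?_ (I.arrivals_nonneg ω t)
  rcases alloc_cases h with h | h <;> rw [h.1]
  linarith

theorem budget_one : I.budget P δ L ω 1 = I.B := by simp [budget, stock]

/-- The lower guardrail is affordable in every round. -/
theorem Good.feasible (h : I.Good P δ ω) (hx : 0 ≤ I.lowerX P δ) (hL : 0 ≤ L)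
    (hF : ∀ t, 0 ≤ I.forecast P δ t)
    (hB : I.lowerX P δ * I.upperN P δ 0 + I.forecast P δ 1 ≤ I.B) :
    ∀ t ∈ Finset.Icc 1 I.T, I.arrivals ω t * I.lowerX P δ ≤ I.budget P δ L ω t := by
  -- Here `s` is the last round up to `m` with the upper guardrail, or `0`. The threshold test of
  -- round `s` precedes the perishing of that round, so losses count from `s` itself; `max s 1`
  -- reflects that there is no round `0`.
  have main : ∀ m ≤ I.T,
      (∀ t ∈ Finset.Icc 1 m, I.arrivals ω t * I.lowerX P δ ≤ I.budget P δ L ω t) ∧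
      ∃ s ≤ m, I.lowerX P δ * I.upperN P δ s + I.forecast P δ (max s 1) ≤
        I.budget P δ L ω (m + 1) + I.lowerX P δ * ∑ r ∈ Finset.Ioc s m, I.arrivals ω r +
          ∑ r ∈ Finset.Icc (max s 1) m, I.lost P δ L ω r := by
    intro m
    induction m with
    | zero =>
      intro _
      refine ⟨by simp, 0, le_rfl, ?_⟩
      simpa [budget_one] using hB
    | succ m ih =>
      intro hm
      obtain ⟨hfeas, s, hs, hinv⟩ := ih (by omega)
      -- Losses since `s` cancel against the forecast and arrivals since `s` against `upperN`,
      -- leaving `x` for each person still to come.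
      have hlost := h.sum_lost_le_forecast hx hL hF (t := m) (by omega)
        (fun r hr => lowerX_mul_le_spend hL (hfeas r hr)) (le_refl (max s 1)) (le_max_right _ _)
      have hU := mul_le_mul_of_nonneg_left (h.le_upperN (s := s) (by omega)) hx
      have hsplit : ∑ r ∈ Finset.Ioc s m, I.arrivals ω r + ∑ r ∈ Finset.Ioc m I.T, I.arrivals ω r =
          ∑ r ∈ Finset.Ioc s I.T, I.arrivals ω r :=
        Finset.sum_Ioc_consecutive _ hs (by omega)
      rw [← hsplit] at hU
      have hone : I.arrivals ω (m + 1) ≤ ∑ r ∈ Finset.Ioc m I.T, I.arrivals ω r :=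
        Finset.single_le_sum (f := fun r => I.arrivals ω r) (fun r _ => I.arrivals_nonneg ω r)
          (Finset.mem_Ioc.2 ⟨by omega, hm⟩)
      have hone' := mul_le_mul_of_nonneg_left hone hx
      have hnew : I.arrivals ω (m + 1) * I.lowerX P δ ≤ I.budget P δ L ω (m + 1) := by
        linarith
      refine ⟨fun t ht => ?_, ?_⟩
      · rw [Finset.mem_Icc] at ht
        rcases Nat.lt_or_ge t (m + 1) with htm | htm
        · exact hfeas t (Finset.mem_Icc.2 (by omega))
        · obtain rfl : t = m + 1 := by omega
          exact hnew
      · have hbs := budget_succ hx hL hF (ω := ω) m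
        have hsp : I.spend P δ L ω (m + 1) = I.arrivals ω (m + 1) * I.alloc P δ L ω (m + 1) := rfl
        rcases alloc_cases hnew with ⟨ha, hc⟩ | ⟨ha, -⟩ <;> rw [ha] at hsp
        · refine ⟨m + 1, le_rfl, ?_⟩
          simp only [Finset.Ioc_self, Finset.sum_empty, mul_zero, add_zero]
          rw [max_eq_left (Nat.le_add_left 1 m), Finset.Icc_self, Finset.sum_singleton]
          change _ ≤ I.budget P δ L ω (m + 2) + _
          linarith
        · refine ⟨s, by omega, ?_⟩
          rw [Finset.sum_Ioc_succ_top hs, Finset.sum_Icc_succ_top (by omega)]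
          change _ ≤ I.budget P δ L ω (m + 2) + _ + _
          linarith
  exact (main I.T le_rfl).1

theorem budget_add_used_add_lost (hx : 0 ≤ I.lowerX P δ) (hL : 0 ≤ L)
    (hF : ∀ t, 0 ≤ I.forecast P δ t) (m : ℕ) :
    I.budget P δ L ω (m + 1) + I.used P δ L ω m + ∑ r ∈ Finset.Icc 1 m, I.lost P δ L ω r
      = I.B := by
  induction m with
  | zero => simp [budget_one, used]
  | succ m ih =>
    have := budget_succ hx hL hF (ω := ω) m
    rw [used_succ, Finset.sum_Icc_succ_top (Nat.le_add_left 1 m)]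
    change I.budget P δ L ω (m + 2) + _ + _ = _
    linarith

theorem inefficiency_eq : I.inefficiency P δ L ω = I.B - I.used P δ L ω I.T := by
  simp only [inefficiency, used, spend, arrivals, Finset.sum_mul]

/-- The inefficiency is controlled by the last round in which the lower guardrail is used. -/
theorem Good.inefficiency_le (h : I.Good P δ ω) (hx : 0 ≤ I.lowerX P δ) (hL : 0 ≤ L)
    (hF : ∀ t, 0 ≤ I.forecast P δ t) {D A : ℝ} (hFD : I.forecast P δ 1 ≤ D)
    (hB : I.lowerX P δ * I.upperN P δ 0 + D = I.B)
    (hA : ∀ t ∈ Finset.Icc 1 I.T, I.arrivals ω t ≤ A) (hA0 : 0 ≤ A) :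
    ∃ s ≤ I.T, I.inefficiency P δ L ω ≤ 2 * D + A * L + I.lowerX P δ * I.upperN P δ s -
      (I.lowerX P δ + L) * ∑ r ∈ Finset.Ioc s I.T, I.arrivals ω r := by
  have hfeas := h.feasible hx hL hF (by linarith)
  have hAL : 0 ≤ A * L := mul_nonneg hA0 hL
  -- Here `s` is the last round with the lower guardrail; `s = 0` if there is none, and then `hB`
  -- gives the bound.
  have main : ∀ m ≤ I.T, ∃ s ≤ m, I.B - I.used P δ L ω m ≤
      2 * D + A * L + I.lowerX P δ * I.upperN P δ s -
      (I.lowerX P δ + L) * ∑ r ∈ Finset.Ioc s m, I.arrivals ω r := by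
    intro m
    induction m with
    | zero =>
      intro _
      refine ⟨0, le_rfl, ?_⟩
      have hD : 0 ≤ D := (hF 1).trans hFD
      simp only [used, Finset.Icc_eq_empty_of_lt Nat.zero_lt_one, Finset.sum_empty,
        Finset.Ioc_self]
      linarith
    | succ m ih =>
      intro hm
      obtain ⟨s, hs, hinv⟩ := ih (by omega)
      have hmem : m + 1 ∈ Finset.Icc 1 I.T := Finset.mem_Icc.2 ⟨by omega, hm⟩
      have hsp : I.spend P δ L ω (m + 1) = I.arrivals ω (m + 1) * I.alloc P δ L ω (m + 1) := rfl
      rcases alloc_cases (hfeas _ hmem) with ⟨ha, -⟩ | ⟨ha, hc⟩ <;> rw [ha] at hsp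
      · refine ⟨s, by omega, ?_⟩
        rw [used_succ, Finset.sum_Ioc_succ_top hs]
        linarith
      -- The failed test bounds the budget. One `D` pays for the current forecast, the other for
      -- past losses, and `A * L` for the increment denied in this round.
      · refine ⟨m + 1, le_rfl, ?_⟩
        have hsum := budget_add_used_add_lost hx hL hF (ω := ω) m
        have hlost := h.sum_lost_le_forecast hx hL hF (t := m) (by omega)
          (fun r hr => lowerX_mul_le_spend hL (hfeas r (by
            rw [Finset.mem_Icc] at hr ⊢; omega))) le_rfl le_rfl
        have hF1 : I.forecast P δ (m + 1) ≤ I.forecast P δ 1 :=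
          forecast_antitone (Nat.le_add_left 1 m)
        have hA' := mul_le_mul_of_nonneg_right (hA _ hmem) hL
        simp only [Finset.Ioc_self, Finset.sum_empty]
        rw [used_succ]
        linarith
  rw [inefficiency_eq]
  exact main I.T le_rfl

end PerishingInstance

namespace PerishingInstance

variable {Ω Θ : Type*} [MeasurableSpace Ω] [Fintype Θ]
variable {I : PerishingInstance Ω Θ} {P : Measure Ω} {δ L : ℝ} {ω : Ω}

/-! ### The probability of the good sample paths -/

theorem Admissible.abs_sub_le_rhoMax (hI : I.Admissible P) {t : ℕ} (ht : t ∈ Finset.Icc 1 I.T)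
    (θ : Θ) : ∀ᵐ ω ∂P, |(I.N t θ ω : ℝ) - ∫ ω', (I.N t θ ω' : ℝ) ∂P| ≤ I.rhoMax P := by
  obtain ⟨C, hC⟩ := hI.bounded_N t ht θ
  have hrho : I.rho P t θ ≤ I.rhoMax P :=
    le_ciSup (f := fun i : Finset.Icc 1 I.T × Θ => I.rho P i.1 i.2)
      (Set.finite_range _).bddAbove ⟨⟨t, ht⟩, θ⟩
  -- A real `essSup` is an almost sure bound only for essentially bounded functions, whence
  -- `bounded_N`.
  filter_upwards [ae_le_essSup (Filter.isBoundedUnder_of_eventually_le hC)] with ω hω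
  exact hω.trans hrho

/-- `confN` is the Hoeffding radius for `(t - s) * card Θ` variables at level `log (2T²/δ)`; the
tail `δ/T²` allows for a union over `T²` intervals. -/
theorem Admissible.measureReal_arrivals_le [IsProbabilityMeasure P] (hI : I.Admissible P)
    (hδ : 0 < δ) (hδ1 : δ < 1) {s t : ℕ} (hst : s ≤ t) (ht : t ≤ I.T) :
    P.real {ω | I.confN P δ s t < |∑ r ∈ Finset.Ioc s t, I.arrivals ω r - I.meanIoc P s t|}
      ≤ δ / (I.T : ℝ) ^ 2 := by
  have hT : (2 : ℝ) ≤ I.T := by exact_mod_cast hI.two_le_T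
  have hq : 1 ≤ 2 * (I.T : ℝ) ^ 2 / δ := by
    rw [le_div_iff₀ hδ]; nlinarith
  have hl : 0 ≤ Real.log (2 * (I.T : ℝ) ^ 2 / δ) := Real.log_nonneg hq
  set X : Finset.Icc 1 I.T × Θ → Ω → ℝ := fun i ω => (I.N i.1 i.2 ω : ℝ) with hX
  have hind : iIndepFun X P :=
    (hI.indep.precomp Sum.inl_injective).comp (fun _ (n : ℕ) => (n : ℝ)) fun _ => by fun_prop
  have hmeas : ∀ i, Measurable (X i) := fun i =>
    (measurable_from_top (f := fun n : ℕ => (n : ℝ))).comp (hI.measurable_N _ i.1.2 i.2)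
  set S : Finset (Finset.Icc 1 I.T × Θ) :=
    (Finset.Ioc s t).subtype (· ∈ Finset.Icc 1 I.T) ×ˢ Finset.univ with hS
  have hsub : ∀ r ∈ Finset.Ioc s t, r ∈ Finset.Icc 1 I.T := fun r hr => by
    rw [Finset.mem_Ioc] at hr
    rw [Finset.mem_Icc]
    omega
  have hcard : (S.card : ℝ) = ((t : ℝ) - s) * Fintype.card Θ := by
    rw [hS, Finset.card_product, Finset.card_subtype, Finset.filter_true_of_mem hsub,
      Nat.card_Ioc, Finset.card_univ]
    push_cast [Nat.cast_sub hst]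
    rfl
  have h := measureReal_hoeffding_le hind hmeas S
    (fun i _ => hI.abs_sub_le_rhoMax i.1.2 i.2) hl
  have hexp : 2 * Real.exp (-Real.log (2 * (I.T : ℝ) ^ 2 / δ)) = δ / (I.T : ℝ) ^ 2 := by
    rw [Real.exp_neg, Real.exp_log (by linarith)]
    field_simp
  have hconf : √(2 * S.card * I.rhoMax P ^ 2 * Real.log (2 * (I.T : ℝ) ^ 2 / δ)) =
      I.confN P δ s t := by
    rw [hcard, confN]
    ring_nf
  have hsum : ∀ ω, ∑ i ∈ S, (X i ω - ∫ ω', X i ω' ∂P) =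
      ∑ r ∈ Finset.Ioc s t, I.arrivals ω r - I.meanIoc P s t := by
    intro ω
    rw [hS, Finset.sum_product, Finset.sum_subtype_of_mem
      (fun r => ∑ θ, ((I.N r θ ω : ℝ) - ∫ ω', (I.N r θ ω' : ℝ) ∂P)) hsub]
    simp only [arrivals, meanIoc, meanArrivals, Finset.sum_sub_distrib]
  rw [hexp, hconf] at h
  simpa only [hsum] using h

/-- By `confP_sq` the Chernoff exponent at `c = confP` is exactly `-logConf`. -/
theorem Admissible.measureReal_spoilCount_le [IsProbabilityMeasure P] (hI : I.Admissible P)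
    (hδ : 0 < δ) (hδ1 : δ < 1) {t : ℕ} (ht : 1 ≤ t) :
    P.real {ω | I.eta P δ t + I.confP δ t (I.eta P δ t) < I.spoilCount P δ ω t}
      ≤ δ / (3 * t * Real.log I.T) := by
  have hT := hI.two_le_T
  have hc := confP_pos hT hδ hδ1 ht (I.eta P δ t)
  have hη := I.eta_nonneg P δ t
  have hind : iIndepFun I.perishTime P := by
    have h := hI.indep.precomp (Sum.inr_injective (α := Finset.Icc 1 I.T × Θ) (β := Fin I.B))
    exact h
  have h := measureReal_chernoff_le hind hI.measurable_perishTime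
    (A := fun b => I.spoilSet P δ t b) (fun _ => MeasurableSet.of_discrete)
    (I.slowRemaining P δ t) hc
  have heta : ∑ b ∈ I.slowRemaining P δ t, P.real {ω | I.perishTime b ω ∈ I.spoilSet P δ t b} =
    I.eta P δ t := rfl
  rw [heta, neg_div, confP_sq hT hδ hδ1 ht hη, mul_div_assoc, div_self (by positivity), mul_one,
    Real.exp_neg, logConf, Real.exp_log, inv_div] at h
  · exact h
  · have := half_lt_log_T hT
    have : (1 : ℝ) ≤ t := by exact_mod_cast ht
    positivity

theorem Admissible.measure_not_good_le [IsProbabilityMeasure P] (hI : I.Admissible P)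
    (hδ : 0 < δ) (hδ1 : δ < 1) : P {ω | ¬ I.Good P δ ω} ≤ ENNReal.ofReal (2 * δ) := by
  have hT := hI.two_le_T
  have hTpos : (0 : ℝ) < I.T := by exact_mod_cast (by omega : 0 < I.T)
  have hlog := half_lt_log_T hT
  set E₁ : Set Ω := {ω | ¬ ∀ t ∈ Finset.Icc 1 I.T, ∀ θ, 1 ≤ I.N t θ ω} with hE₁
  set E₂ : Set Ω := ⋃ p ∈ (Finset.range I.T ×ˢ Finset.Icc 1 I.T).filter (fun p => p.1 ≤ p.2),
    {ω | I.confN P δ p.1 p.2 <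
      |∑ r ∈ Finset.Ioc p.1 p.2, I.arrivals ω r - I.meanIoc P p.1 p.2|} with hE₂
  set E₃ : Set Ω := ⋃ t ∈ Finset.Icc 1 I.T,
    {ω | I.eta P δ t + I.confP δ t (I.eta P δ t) < I.spoilCount P δ ω t} with hE₃
  have h₁ : P.real E₁ = 0 := by
    rw [measureReal_eq_zero_iff]
    refine ae_iff.1 ((ae_ball_iff (Finset.countable_toSet _)).2 fun t ht => ?_)
    exact ae_all_iff.2 fun θ => hI.one_le_N t ht θ
  have h₂ : P.real E₂ ≤ δ := by
    refine (measureReal_biUnion_finset_le _ _).trans ?_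
    calc _ ≤ ∑ p ∈ (Finset.range I.T ×ˢ Finset.Icc 1 I.T).filter (fun p => p.1 ≤ p.2),
          δ / (I.T : ℝ) ^ 2 := by
            refine Finset.sum_le_sum fun p hp => ?_
            simp only [Finset.mem_filter, Finset.mem_product, Finset.mem_Icc] at hp
            exact hI.measureReal_arrivals_le hδ hδ1 hp.2 hp.1.2.2
      _ ≤ ∑ p ∈ Finset.range I.T ×ˢ Finset.Icc 1 I.T, δ / (I.T : ℝ) ^ 2 :=
            Finset.sum_le_sum_of_subset_of_nonneg (Finset.filter_subset _ _)
              fun _ _ _ => by positivity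
      _ = δ := by
            rw [Finset.sum_const, Finset.card_product, Finset.card_range, Nat.card_Icc]
            simp only [Nat.add_sub_cancel, nsmul_eq_mul]
            push_cast
            field_simp
  have h₃ : P.real E₃ ≤ δ := by
    refine (measureReal_biUnion_finset_le _ _).trans ?_
    -- The tails sum to a harmonic series, at most `1 + log T ≤ 3 * log T` because `log T > 1/2`;
    -- this is the role of the `3` in `confP`.
    have hharm := harmonic_le_one_add_log I.T
    rw [harmonic_eq_sum_Icc] at hharm
    push_cast at hharm
    calc _ ≤ ∑ t ∈ Finset.Icc 1 I.T, δ / (3 * Real.log I.T) * (t : ℝ)⁻¹ := by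
            refine Finset.sum_le_sum fun t ht => ?_
            refine (hI.measureReal_spoilCount_le hδ hδ1 (Finset.mem_Icc.1 ht).1).trans_eq ?_
            have : (t : ℝ) ≠ 0 := by
              have := (Finset.mem_Icc.1 ht).1
              positivity
            field_simp
      _ ≤ δ / (3 * Real.log I.T) * (3 * Real.log I.T) := by
            rw [← Finset.mul_sum]
            exact mul_le_mul_of_nonneg_left (by linarith) (by positivity)
      _ = δ := div_mul_cancel₀ _ (by positivity)
  have hsub : {ω | ¬ I.Good P δ ω} ⊆ E₁ ∪ E₂ ∪ E₃ := by
    intro ω hω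
    by_contra hcon
    simp only [Set.mem_union, not_or] at hcon
    obtain ⟨⟨h1, h2⟩, h3⟩ := hcon
    refine hω ⟨not_not.1 h1, fun s t hst ht => ?_, fun t ht => ?_⟩
    -- Empty intervals are trivial; the nonempty ones have `s < T` and `t ≥ 1`, hence at most `T²`
    -- pairs in `E₂`.
    · rcases hst.eq_or_lt with rfl | hlt
      · simp [confN_self, meanIoc_self]
      · by_contra hc
        refine h2 (Set.mem_biUnion (x := (s, t)) ?_ (not_le.1 hc))
        simp only [Finset.coe_filter, Finset.mem_product, Finset.mem_range, Finset.mem_Icc,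
          Set.mem_ofPred_eq]
        omega
    · by_contra hc
      exact h3 (Set.mem_biUnion (x := t) ht (not_le.1 hc))
  rw [← ofReal_measureReal]
  refine ENNReal.ofReal_le_ofReal ?_
  calc _ ≤ P.real (E₁ ∪ E₂ ∪ E₃) := measureReal_mono hsub
    _ ≤ P.real (E₁ ∪ E₂) + P.real E₃ := measureReal_union_le _ _
    _ ≤ P.real E₁ + P.real E₂ + P.real E₃ := by gcongr; exact measureReal_union_le _ _
    _ ≤ 2 * δ := by linarith

/-- A property of all good sample paths holds with probability at least `1 - 2δ`. -/
theorem Admissible.le_measure_of_good [IsProbabilityMeasure P] (hI : I.Admissible P)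
    (hδ : 0 < δ) (hδ1 : δ < 1) {A : Set Ω} (hA : ∀ ω, I.Good P δ ω → ω ∈ A) :
    ENNReal.ofReal (1 - 2 * δ) ≤ P A := by
  -- Subadditivity suffices, so `A` need not be measurable.
  have h1 : P Set.univ ≤ P A + P {ω | ¬ I.Good P δ ω} := by
    refine (measure_mono fun ω _ => ?_).trans (measure_union_le _ _)
    by_cases h : I.Good P δ ω
    · exact Or.inl (hA ω h)
    · exact Or.inr h
  rw [measure_univ] at h1
  rw [ENNReal.ofReal_sub _ (by positivity), ENNReal.ofReal_one]
  exact tsub_le_iff_right.2 (h1.trans (add_le_add_right (hI.measure_not_good_le hδ hδ1) _))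

end PerishingInstance

namespace PerishingInstance

variable {Ω Θ : Type*} [MeasurableSpace Ω] [Fintype Θ]
variable {I : PerishingInstance Ω Θ} {P : Measure Ω} {δ L : ℝ} {ω : Ω}

/-! ### Bounds by polynomial factors -/

theorem Admissible.one_le_meanArrivals [Nonempty Θ] [IsProbabilityMeasure P] (hI : I.Admissible P)
    {t : ℕ} (ht : t ∈ Finset.Icc 1 I.T) : 1 ≤ I.meanArrivals P t := by
  have hone : ∀ θ, 1 ≤ ∫ ω, (I.N t θ ω : ℝ) ∂P := by
    intro θ
    obtain ⟨C, hC⟩ := hI.bounded_N t ht θ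
    -- Integrability comes from `bounded_N`; otherwise the integral would have the default value
    -- `0`.
    have hint : Integrable (fun ω => (I.N t θ ω : ℝ)) P := by
      refine Integrable.of_bound (C := C + |∫ ω', (I.N t θ ω' : ℝ) ∂P|)
        ((measurable_from_top (f := fun n : ℕ => (n : ℝ))).comp
          (hI.measurable_N t ht θ)).aestronglyMeasurable ?_
      filter_upwards [hC] with ω hω
      rw [Real.norm_eq_abs]
      have := abs_sub_abs_le_abs_sub (I.N t θ ω : ℝ) (∫ ω', (I.N t θ ω' : ℝ) ∂P)
      linarith
    have h1 : ∫ _ω, (1 : ℝ) ∂P ≤ ∫ ω, (I.N t θ ω : ℝ) ∂P := by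
      refine integral_mono_ae (integrable_const _) hint ?_
      filter_upwards [hI.one_le_N t ht θ] with ω hω
      exact_mod_cast hω
    simpa using h1
  obtain ⟨θ⟩ := ‹Nonempty Θ›
  exact (hone θ).trans (Finset.single_le_sum (f := fun θ => ∫ ω, (I.N t θ ω : ℝ) ∂P)
    (fun θ _ => zero_le_one.trans (hone θ)) (Finset.mem_univ θ))

theorem Admissible.meanIoc_pos [Nonempty Θ] [IsProbabilityMeasure P] (hI : I.Admissible P) :
    0 < I.meanIoc P 0 I.T := by
  have hT := hI.two_le_T
  have h1 := hI.one_le_meanArrivals (t := 1) (Finset.mem_Icc.2 ⟨le_rfl, by omega⟩)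
  have h2 : I.meanArrivals P 1 ≤ I.meanIoc P 0 I.T :=
    Finset.single_le_sum (f := fun r => I.meanArrivals P r)
      (fun r _ => I.meanArrivals_nonneg P r) (Finset.mem_Ioc.2 ⟨Nat.zero_lt_one, by omega⟩)
  linarith

theorem Admissible.rhoMax_nonneg [Nonempty Θ] [IsProbabilityMeasure P] (hI : I.Admissible P) :
    0 ≤ I.rhoMax P := by
  have hT := hI.two_le_T
  obtain ⟨θ⟩ := ‹Nonempty Θ›
  obtain ⟨ω, hω⟩ := (hI.abs_sub_le_rhoMax (t := 1) (Finset.mem_Icc.2 ⟨le_rfl, by omega⟩) θ).exists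
  exact (abs_nonneg _).trans hω

theorem meanArrivals_le_muMax {t : ℕ} (ht : t ∈ Finset.Icc 1 I.T) :
    I.meanArrivals P t ≤ I.muMax P :=
  le_ciSup (f := fun t : Finset.Icc 1 I.T => I.meanArrivals P t)
    (Set.finite_range _).bddAbove ⟨t, ht⟩

/-- The parameters are at most the polynomial factor. -/
structure FactorBounds (I : PerishingInstance Ω Θ) (P : Measure Ω) (δ M : ℝ) : Prop where
  one_le : 1 ≤ M
  betaAvg_le : I.betaAvg P ≤ M
  card_le : (Fintype.card Θ : ℝ) ≤ M
  wMax_le : I.wMax ≤ M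
  muMax_le : I.muMax P ≤ M
  rhoMax_le : I.rhoMax P ≤ M
  log_T_le : Real.log I.T ≤ M
  log_inv_le : Real.log (1 / δ) ≤ M

theorem Admissible.factorBounds [Nonempty Θ] [IsProbabilityMeasure P] (hI : I.Admissible P)
    (hδ : 0 < δ) (hδ1 : δ < 1) : I.FactorBounds P δ (I.factor P δ) := by
  -- The product is built one factor at a time, keeping it above every parameter already included.
  have step : ∀ {p x : ℝ}, 1 ≤ p → 0 ≤ x → 1 ≤ p * (1 + x) ∧ p ≤ p * (1 + x) ∧ x ≤ p * (1 + x) :=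
    fun hp hx => ⟨by nlinarith, by nlinarith, by nlinarith⟩
  have hβ : 0 ≤ I.betaAvg P := div_nonneg (Nat.cast_nonneg _) (I.meanIoc_nonneg P _ _)
  have hw : 0 ≤ I.wMax := Real.iSup_nonneg fun θ => (hI.w_pos θ).le
  have hμ : 0 ≤ I.muMax P := Real.iSup_nonneg fun t => I.meanArrivals_nonneg P _
  have hv : 0 ≤ I.varMin P := Real.iInf_nonneg fun i => variance_nonneg _ _
  have hv' : 0 ≤ I.varMax P := Real.iSup_nonneg fun i => variance_nonneg _ _
  have hlT : 0 ≤ Real.log I.T := by linarith [half_lt_log_T hI.two_le_T]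
  have hlδ : 0 ≤ Real.log (1 / δ) := Real.log_nonneg (by rw [le_div_iff₀ hδ]; linarith)
  have h1 : 1 ≤ 1 + I.betaAvg P := by linarith
  have h1' : I.betaAvg P ≤ 1 + I.betaAvg P := by linarith
  obtain ⟨h2, i2, j2⟩ := step h1 (Nat.cast_nonneg (Fintype.card Θ))
  obtain ⟨h3, i3, j3⟩ := step h2 hw
  obtain ⟨h4, i4, j4⟩ := step h3 hμ
  obtain ⟨h5, i5, -⟩ := step h4 hv
  obtain ⟨h6, i6, -⟩ := step h5 hv'
  obtain ⟨h7, i7, j7⟩ := step h6 hI.rhoMax_nonneg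
  obtain ⟨h8, i8, j8⟩ := step h7 hlT
  obtain ⟨h9, i9, j9⟩ := step h8 hlδ
  have k7 := i8.trans i9
  have k4 := ((i5.trans i6).trans i7).trans k7
  have k3 := i4.trans k4
  have k2 := i3.trans k3
  exact ⟨h9, (h1'.trans i2).trans k2, j2.trans k2, j3.trans k3, j4.trans k4, j7.trans k7,
    j8.trans i9, j9⟩

section

variable {M : ℝ} (hI : I.Admissible P) (hM : I.FactorBounds P δ M) (hδ : 0 < δ)
include hI hM hδ

theorem FactorBounds.confN_le [Nonempty Θ] [IsProbabilityMeasure P] (hδ1 : δ < 1) {s t : ℕ}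
    (hst : s ≤ t) : I.confN P δ s t ≤ 3 * M ^ 2 * √((t : ℝ) - s) := by
  have hM1 := hM.one_le
  have hT : (2 : ℝ) ≤ I.T := by exact_mod_cast hI.two_le_T
  have hn : (0 : ℝ) ≤ t - s := sub_nonneg.2 (by exact_mod_cast hst)
  have hl : Real.log (2 * (I.T : ℝ) ^ 2 / δ) ≤ 4 * M := by
    have h2 : Real.log (2 * (I.T : ℝ) ^ 2 / δ) =
        Real.log 2 + 2 * Real.log I.T + Real.log (1 / δ) := by
      rw [mul_div_assoc, Real.log_mul (by norm_num) (by positivity), div_eq_mul_one_div,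
        Real.log_mul (by positivity) (by positivity), Real.log_pow]
      push_cast
      ring
    linarith [hM.log_T_le, hM.log_inv_le, Real.log_two_lt_d9]
  have hl0 : 0 ≤ Real.log (2 * (I.T : ℝ) ^ 2 / δ) := by
    refine Real.log_nonneg ?_
    rw [le_div_iff₀ hδ]
    nlinarith
  have hρ := hI.rhoMax_nonneg
  have hρM := hM.rhoMax_le
  have hcM := hM.card_le
  rw [confN]
  refine Real.sqrt_le_iff.2 ⟨by positivity, ?_⟩
  rw [mul_pow, Real.sq_sqrt hn]
  calc 2 * ((t : ℝ) - s) * (Fintype.card Θ : ℝ) * I.rhoMax P ^ 2 *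
        Real.log (2 * (I.T : ℝ) ^ 2 / δ)
      ≤ 2 * ((t : ℝ) - s) * M * M ^ 2 * (4 * M) := by gcongr
    _ = 8 * (M ^ 4 * ((t : ℝ) - s)) := by ring
    -- Rounding `8` up to `9` makes the square root explicit.
    _ ≤ 9 * (M ^ 4 * ((t : ℝ) - s)) := by
        have : 0 ≤ M ^ 4 * ((t : ℝ) - s) := by positivity
        linarith
    _ = _ := by ring

theorem FactorBounds.upperN_zero_le [Nonempty Θ] [IsProbabilityMeasure P] (hδ1 : δ < 1) :
    I.upperN P δ 0 ≤ 4 * M ^ 2 * I.T := by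
  have hM1 := hM.one_le
  have hT : (2 : ℝ) ≤ I.T := by exact_mod_cast hI.two_le_T
  have h1 : I.meanIoc P 0 I.T ≤ I.T * M := by
    calc I.meanIoc P 0 I.T ≤ ∑ _r ∈ Finset.Ioc 0 I.T, M := by
          refine Finset.sum_le_sum fun r hr => (meanArrivals_le_muMax ?_).trans hM.muMax_le
          rw [Finset.mem_Ioc] at hr
          rw [Finset.mem_Icc]
          omega
      _ = _ := by simp
  have h2 := hM.confN_le hI hδ hδ1 (Nat.zero_le I.T)
  have h3 : √((I.T : ℝ) - (0 : ℕ)) ≤ I.T := by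
    rw [Nat.cast_zero, sub_zero]
    exact Real.sqrt_le_iff.2 ⟨by positivity, by nlinarith⟩
  have h4 : 3 * M ^ 2 * √((I.T : ℝ) - (0 : ℕ)) ≤ 3 * M ^ 2 * I.T := by gcongr
  have hMM : M ≤ M ^ 2 := by nlinarith
  have h5 : I.T * M ≤ I.T * M ^ 2 := by gcongr
  rw [upperN]
  linarith

theorem FactorBounds.arrivals_le [Nonempty Θ] [IsProbabilityMeasure P] (hδ1 : δ < 1)
    (hω : I.Good P δ ω) {t : ℕ} (ht : t ∈ Finset.Icc 1 I.T) : I.arrivals ω t ≤ 4 * M ^ 2 := by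
  have hM1 := hM.one_le
  have ht' := Finset.mem_Icc.1 ht
  obtain ⟨s, rfl⟩ : ∃ s, t = s + 1 := Nat.exists_eq_add_of_le' ht'.1
  have h1 := (abs_le.1 (hω.arrivals_close s (s + 1) (Nat.le_succ s) ht'.2)).2
  have h2 := hM.confN_le hI hδ hδ1 (Nat.le_succ s)
  have h3 := (meanArrivals_le_muMax (P := P) ht).trans hM.muMax_le
  have hs : Finset.Ioc s (s + 1) = {s + 1} := by ext; simp
  rw [meanIoc, hs, Finset.sum_singleton, Finset.sum_singleton] at h1
  have h4 : ((s.succ : ℕ) : ℝ) - s = 1 := by push_cast; ring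
  rw [h4, Real.sqrt_one] at h2
  change I.confN P δ s (s + 1) ≤ _ at h2
  nlinarith

theorem lowerX_le [Nonempty Θ] [IsProbabilityMeasure P] (hδ1 : δ < 1) :
    (I.B : ℝ) / I.upperN P δ 0 ≤ M ∧ I.lowerX P δ ≤ M := by
  have hpos := hI.meanIoc_pos
  have h1 : I.meanIoc P 0 I.T ≤ I.upperN P δ 0 := le_add_of_nonneg_right (I.confN_nonneg P δ _ _)
  have h2 : (I.B : ℝ) / I.upperN P δ 0 ≤ M :=
    (div_le_div_of_nonneg_left (Nat.cast_nonneg _) hpos h1).trans hM.betaAvg_le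
  have h3 := (lowerX_fixed (P := P) hI.two_le_T hδ hδ1).2
  have h4 := worstLoss_nonneg (P := P) hI.two_le_T hδ hδ1 (I.lowerX P δ)
  refine ⟨h2, h3.trans_le (le_trans ?_ h2)⟩
  exact div_le_div_of_nonneg_right (sub_le_self _ h4) (I.upperN_nonneg P δ 0)

/-- Allocations are `x` or `x + L`, and `x ≤ B/upperN 0 ≤ B/N`. The first gap is `perishLoss`; the
second is of order `1/√T`, since `N ≥ T` and `upperN 0 - N` is at most twice the confidence radius.
-/
theorem FactorBounds.envy_le [Nonempty Θ] [IsProbabilityMeasure P] (hδ1 : δ < 1) (hL : 0 < L)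
    (hω : I.Good P δ ω) :
    I.envy P δ L ω ≤ M * (L + I.perishLoss P δ + 6 * M ^ 3 * (1 / √(I.T : ℝ))) := by
  have hM1 := hM.one_le
  have hT2 := hI.two_le_T
  have hT : (2 : ℝ) ≤ I.T := by exact_mod_cast hT2
  have hF := forecast_nonneg (P := P) hT2 hδ hδ1
  obtain ⟨hx, hfix⟩ := lowerX_fixed (P := P) hT2 hδ hδ1
  have hU : 0 < I.upperN P δ 0 :=
    hI.meanIoc_pos.trans_le (le_add_of_nonneg_right (I.confN_nonneg P δ _ _))
  have hW := worstLoss_nonneg (P := P) hT2 hδ hδ1 (I.lowerX P δ)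
  have hF1 := forecast_one_le_worstLoss (P := P) hT2 hδ hδ1
  have hB : I.lowerX P δ * I.upperN P δ 0 + I.worstLoss P δ (I.lowerX P δ) = I.B := by
    rw [eq_div_iff hU.ne'] at hfix
    linarith
  have hfeas := hω.feasible hx hL.le hF (by linarith)
  have hBM := (lowerX_le hI hM hδ hδ1).1
  set x := I.lowerX P δ with hxdef
  have hLp : 0 ≤ I.perishLoss P δ := by
    rw [perishLoss, ← hxdef, sub_nonneg, le_div_iff₀ hU]
    linarith
  have hN : I.totalArrivals ω = ∑ r ∈ Finset.Ioc 0 I.T, I.arrivals ω r := by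
    rw [totalArrivals]
    rfl
  have hNT : (I.T : ℝ) ≤ I.totalArrivals ω := by
    have := hω.sub_le_sum_arrivals (Nat.zero_le I.T)
    rw [hN]
    simpa using this
  have hNU : I.totalArrivals ω ≤ I.upperN P δ 0 := by
    rw [hN]; exact hω.le_upperN (Nat.zero_le _)
  have hUN : I.upperN P δ 0 ≤ I.totalArrivals ω + 6 * M ^ 2 * √(I.T : ℝ) := by
    have h1 := hω.upperN_le (Nat.zero_le I.T)
    have h2 := hM.confN_le hI hδ hδ1 (Nat.zero_le I.T)
    rw [Nat.cast_zero, sub_zero] at h2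
    rw [hN]
    linarith
  have hgap : (I.B : ℝ) / I.totalArrivals ω - I.B / I.upperN P δ 0 ≤
      6 * M ^ 3 * (1 / √(I.T : ℝ)) := by
    have hNpos : 0 < I.totalArrivals ω := by linarith
    have hs : 0 < √(I.T : ℝ) := Real.sqrt_pos.2 (by linarith)
    have hss : √(I.T : ℝ) * √(I.T : ℝ) = I.T := Real.mul_self_sqrt (by linarith)
    calc (I.B : ℝ) / I.totalArrivals ω - I.B / I.upperN P δ 0
        = I.B / I.upperN P δ 0 * ((I.upperN P δ 0 - I.totalArrivals ω) / I.totalArrivals ω) := by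
          field_simp
      _ ≤ M * (6 * M ^ 2 * √(I.T : ℝ) / I.T) := by
          gcongr
          linarith
      _ = 6 * M ^ 3 * (1 / √(I.T : ℝ)) := by
          have hv : ∀ v : ℝ, 0 < v → M * (6 * M ^ 2 * v / (v * v)) = 6 * M ^ 3 * (1 / v) := by
            intro v hv
            field_simp
          rw [← hv _ hs, hss]
  have hgap0 : (I.B : ℝ) / I.upperN P δ 0 ≤ I.B / I.totalArrivals ω :=
    div_le_div_of_nonneg_left (Nat.cast_nonneg _) (by linarith) hNU
  have hR : 0 ≤ 6 * M ^ 3 * (1 / √(I.T : ℝ)) := by positivity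
  refine Real.iSup_le (fun i => ?_) (by positivity)
  have hw : I.w i.2 ≤ M :=
    (le_ciSup (f := I.w) (Set.finite_range _).bddAbove i.2).trans hM.wMax_le
  rw [abs_mul, abs_of_pos (hI.w_pos i.2)]
  refine mul_le_mul hw ?_ (abs_nonneg _) (by linarith)
  have hLpdef : I.perishLoss P δ = I.B / I.upperN P δ 0 - x := rfl
  rw [abs_le]
  rcases alloc_cases (hfeas i.1 i.1.2) with h | h <;> rw [h.1] <;> constructor <;> linarith

theorem FactorBounds.inefficiency_le [Nonempty Θ] [IsProbabilityMeasure P] (hδ1 : δ < 1)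
    (hL : 0 < L) (hω : I.Good P δ ω) :
    0 ≤ I.perishLoss P δ ∧ I.inefficiency P δ L ω ≤
      8 * M ^ 2 * (I.T * I.perishLoss P δ) + 4 * M ^ 2 * L + 9 * M ^ 6 * L⁻¹ := by
  have hM1 := hM.one_le
  have hT2 := hI.two_le_T
  have hF := forecast_nonneg (P := P) hT2 hδ hδ1
  obtain ⟨hx, hfix⟩ := lowerX_fixed (P := P) hT2 hδ hδ1
  have hU : 0 < I.upperN P δ 0 :=
    hI.meanIoc_pos.trans_le (le_add_of_nonneg_right (I.confN_nonneg P δ _ _))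
  have hW := worstLoss_nonneg (P := P) hT2 hδ hδ1 (I.lowerX P δ)
  have hF1 := forecast_one_le_worstLoss (P := P) hT2 hδ hδ1
  have hB : I.lowerX P δ * I.upperN P δ 0 + I.worstLoss P δ (I.lowerX P δ) = I.B := by
    rw [eq_div_iff hU.ne'] at hfix
    linarith
  have hxM := (lowerX_le hI hM hδ hδ1).2
  obtain ⟨s, hs, hineff⟩ := hω.inefficiency_le hx hL.le hF hF1 hB
    (fun t ht => hM.arrivals_le hI hδ hδ1 hω ht) (by positivity)
  set x := I.lowerX P δ with hxdef
  have hLp : I.upperN P δ 0 * I.perishLoss P δ = I.worstLoss P δ x := by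
    rw [perishLoss, ← hxdef, mul_sub, mul_div_cancel₀ _ hU.ne']
    linarith
  have hLp0 : 0 ≤ I.perishLoss P δ := by
    by_contra h
    push Not at h
    nlinarith
  refine ⟨hLp0, ?_⟩
  have hD : I.worstLoss P δ x ≤ 4 * M ^ 2 * (I.T * I.perishLoss P δ) := by
    rw [← hLp, ← mul_assoc]
    exact mul_le_mul_of_nonneg_right (hM.upperN_zero_le hI hδ hδ1) hLp0
  have hUs := hω.upperN_le hs
  have hS := hω.sub_le_sum_arrivals hs
  have hc := hM.confN_le hI hδ hδ1 hs
  have hn : (0 : ℝ) ≤ (I.T : ℝ) - s := sub_nonneg.2 (by exact_mod_cast hs)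
  set n := (I.T : ℝ) - s
  set A := ∑ r ∈ Finset.Ioc s I.T, I.arrivals ω r
  have h1 : x * I.upperN P δ s ≤ x * (A + 2 * I.confN P δ s I.T) :=
    mul_le_mul_of_nonneg_left hUs hx
  have h2 : x * I.confN P δ s I.T ≤ M * (3 * M ^ 2 * √n) :=
    mul_le_mul hxM hc (I.confN_nonneg P δ _ _) (by linarith)
  have h3 : L * n ≤ L * A := mul_le_mul_of_nonneg_left hS hL.le
  -- Completing the square in `√n` removes the dependence on the unknown round `s`; this is the
  -- source of `L⁻¹`.
  have h4 : 6 * M ^ 3 * √n - L * n ≤ 9 * M ^ 6 * L⁻¹ := by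
    rw [← div_eq_mul_inv, le_div_iff₀ hL]
    have hsq : (3 * M ^ 3 - L * √n) ^ 2 = 9 * M ^ 6 - (6 * M ^ 3 * √n - L * n) * L := by
      linear_combination L ^ 2 * Real.sq_sqrt hn
    linarith [sq_nonneg (3 * M ^ 3 - L * √n)]
  linarith

end

end PerishingInstance

/-! ### Collecting constants and powers of the factor. -/

theorem pow_absorb {M : ℝ} (hM : 1 ≤ M) {a b : ℕ} (h : a ≤ b) {c : ℝ} (hc : 0 ≤ c) :
    c * M ^ a ≤ c * M ^ b :=
  mul_le_mul_of_nonneg_left (pow_le_pow_right₀ hM h) hc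

theorem mainTheorem4 (K : ℝ) (k : ℕ) :
    ∃ (K' : ℝ) (k' : ℕ), 0 < K' ∧
      ∀ (Ω Θ : Type*) [MeasurableSpace Ω] [Fintype Θ] [Nonempty Θ]
        (P : Measure Ω) [IsProbabilityMeasure P]
        (I : PerishingInstance Ω Θ) (_ : I.Admissible P)
        (δ : ℝ) (_ : 0 < δ) (_ : δ < 1) (L : ℝ) (_ : 0 < L)
        (_ : L ≤ K * I.factor P δ ^ k)
        (_ : 1 / √(I.T : ℝ) ≤ K * I.factor P δ ^ k * L)
        (_ : I.perishLoss P δ ≤ K * I.factor P δ ^ k * (1 / √(I.T : ℝ))),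
        ((I.T : ℝ) * I.perishLoss P δ ≤ K * I.factor P δ ^ k * L⁻¹ →
          ENNReal.ofReal (1 - 2 * δ) ≤
            P {ω | I.envy P δ L ω ≤ K' * I.factor P δ ^ k' * L ∧
              I.inefficiency P δ L ω ≤ K' * I.factor P δ ^ k' * L⁻¹}) ∧
        (L⁻¹ ≤ K * I.factor P δ ^ k * ((I.T : ℝ) * I.perishLoss P δ) →
          ENNReal.ofReal (1 - 2 * δ) ≤
            P {ω | I.envy P δ L ω ≤ K' * I.factor P δ ^ k' * L ∧
              I.inefficiency P δ L ω ≤ K' * I.factor P δ ^ k' *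
                ((I.T : ℝ) * I.perishLoss P δ)}) := by
  -- The constant is the sum of the three obtained below: `1 + 6K + K²` for envy, `9 + 8K + 4K²` and
  -- `8 + 9K + 4K³` for inefficiency. The exponent dominates all powers that occur, such as `3k + 2`
  -- and `k + 6`.
  refine ⟨18 + 23 * |K| + 5 * |K| ^ 2 + 4 * |K| ^ 3, 3 * k + 6, by positivity, ?_⟩
  intro Ω Θ _ _ _ P _ I hI δ hδ hδ1 L hL hLK hTL hpl
  have hM := hI.factorBounds hδ hδ1
  set M := I.factor P δ
  have hM1 := hM.one_le
  have hK : 0 < K := by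
    by_contra h
    push Not at h
    have := mul_nonpos_of_nonpos_of_nonneg h (by positivity : 0 ≤ M ^ k)
    linarith
  rw [abs_of_pos hK]
  set Q := M ^ (3 * k + 6)
  have hQ : 0 < Q := by positivity
  set q := M ^ k with hq
  have hq1 : 1 ≤ q := one_le_pow₀ hM1
  -- powers of the factor
  have e1 : M ≤ Q := by simpa using pow_absorb hM1 (show 1 ≤ 3 * k + 6 by omega) zero_le_one
  have e2 : M ^ 2 ≤ Q := pow_le_pow_right₀ hM1 (by omega)
  have e3 : M * (q * q) ≤ Q := by
    rw [hq, ← pow_add, ← pow_succ']; exact pow_le_pow_right₀ hM1 (by omega)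
  have e4 : M ^ 4 * q ≤ Q := by
    rw [hq, ← pow_add]; exact pow_le_pow_right₀ hM1 (by omega)
  have e5 : M ^ 6 ≤ Q := pow_le_pow_right₀ hM1 (by omega)
  have e6 : M ^ 2 * (q * q) ≤ Q := by
    rw [hq, ← pow_add, ← pow_add]; exact pow_le_pow_right₀ hM1 (by omega)
  have e7 : M ^ 2 * q ≤ Q := by
    rw [hq, ← pow_add]; exact pow_le_pow_right₀ hM1 (by omega)
  have e8 : M ^ 6 * q ≤ Q := by
    rw [hq, ← pow_add]; exact pow_le_pow_right₀ hM1 (by omega)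
  have e9 : M ^ 2 * (q * q * q) ≤ Q := by
    rw [hq, ← pow_add, ← pow_add, ← pow_add]; exact pow_le_pow_right₀ hM1 (by omega)
  set K' := 18 + 23 * K + 5 * K ^ 2 + 4 * K ^ 3
  have hKq : 0 ≤ K * q := by positivity
  have henvy : ∀ ω, I.Good P δ ω → I.envy P δ L ω ≤ K' * Q * L := by
    intro ω hω
    have h1 := hM.envy_le hI hδ hδ1 hL hω
    have h2 : I.perishLoss P δ ≤ K * q * (K * q * L) :=
      hpl.trans (mul_le_mul_of_nonneg_left hTL hKq)
    have h3 : 6 * M ^ 3 * (1 / √(I.T : ℝ)) ≤ 6 * M ^ 3 * (K * q * L) :=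
      mul_le_mul_of_nonneg_left hTL (by positivity)
    calc I.envy P δ L ω ≤ M * (L + K * q * (K * q * L) + 6 * M ^ 3 * (K * q * L)) :=
          h1.trans (mul_le_mul_of_nonneg_left (by linarith) (by linarith))
      _ = (M + K ^ 2 * (M * (q * q)) + 6 * K * (M ^ 4 * q)) * L := by ring
      _ ≤ (Q + K ^ 2 * Q + 6 * K * Q) * L := by gcongr
      _ = (1 + K ^ 2 + 6 * K) * Q * L := by ring
      _ ≤ K' * Q * L := by
          have : 0 ≤ K ^ 2 := by positivity
          have : 0 ≤ K ^ 3 := by positivity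
          gcongr
          linarith
  -- `L ≲ 1` turns the term of order `L` into one of order `L⁻¹`.
  have hLL : L ≤ K ^ 2 * (q * q) * L⁻¹ := by
    rw [← div_eq_mul_inv, le_div_iff₀ hL]
    calc L * L ≤ (K * q) * (K * q) := mul_le_mul hLK hLK hL.le hKq
      _ = _ := by ring
  have hineff : ∀ ω, I.Good P δ ω → 0 ≤ I.perishLoss P δ ∧ I.inefficiency P δ L ω ≤
      8 * M ^ 2 * (I.T * I.perishLoss P δ) +
        (4 * K ^ 2 * (M ^ 2 * (q * q)) + 9 * M ^ 6) * L⁻¹ := by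
    intro ω hω
    obtain ⟨h0, h1⟩ := hM.inefficiency_le hI hδ hδ1 hL hω
    refine ⟨h0, h1.trans ?_⟩
    have := mul_le_mul_of_nonneg_left hLL (by positivity : 0 ≤ 4 * M ^ 2)
    linarith
  refine ⟨fun hcase => hI.le_measure_of_good hδ hδ1 fun ω hω => ⟨henvy ω hω, ?_⟩,
    fun hcase => hI.le_measure_of_good hδ hδ1 fun ω hω => ⟨henvy ω hω, ?_⟩⟩
  · obtain ⟨h0, h1⟩ := hineff ω hω
    calc I.inefficiency P δ L ω
        ≤ 8 * M ^ 2 * (K * q * L⁻¹) + (4 * K ^ 2 * (M ^ 2 * (q * q)) + 9 * M ^ 6) * L⁻¹ := by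
          refine h1.trans ?_
          gcongr
      _ = (8 * K * (M ^ 2 * q) + 4 * K ^ 2 * (M ^ 2 * (q * q)) + 9 * M ^ 6) * L⁻¹ := by ring
      _ ≤ (8 * K * Q + 4 * K ^ 2 * Q + 9 * Q) * L⁻¹ := by gcongr
      _ = (8 * K + 4 * K ^ 2 + 9) * Q * L⁻¹ := by ring
      _ ≤ K' * Q * L⁻¹ := by
          have : 0 ≤ K ^ 2 := by positivity
          have : 0 ≤ K ^ 3 := by positivity
          gcongr
          linarith
  · obtain ⟨h0, h1⟩ := hineff ω hω
    set Y := (I.T : ℝ) * I.perishLoss P δ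
    have hY : 0 ≤ Y := mul_nonneg (Nat.cast_nonneg _) h0
    calc I.inefficiency P δ L ω
        ≤ 8 * M ^ 2 * Y + (4 * K ^ 2 * (M ^ 2 * (q * q)) + 9 * M ^ 6) * (K * q * Y) := by
          refine h1.trans ?_
          gcongr
      _ = (8 * M ^ 2 + 4 * K ^ 3 * (M ^ 2 * (q * q * q)) + 9 * K * (M ^ 6 * q)) * Y := by ring
      _ ≤ (8 * Q + 4 * K ^ 3 * Q + 9 * K * Q) * Y := by gcongr
      _ = (8 + 4 * K ^ 3 + 9 * K) * Q * Y := by ring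
      _ ≤ K' * Q * Y := by
          have : 0 ≤ K ^ 2 := by positivity
          have : 0 ≤ K ^ 3 := by positivity
          gcongr
          linarith
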